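/- Let $A=\mathbb{C}[X]$ with $\partial=d/dX$. A differential module is a finitely generated $A$-module $P$ (automatically free) with a $\mathbb{C}$-linear map $\partial:P\to P$ satisfying $\partial(xa)=(\partial x)a+x\,\partial a$; equivalently, a right module over the first Weyl algebra $A[Y,\partial]$ that is finitely generated over $A$. Morphisms are the $A$-linear maps commuting with $\partial$, $T_P$ is the endomorphism ring of $P$, and $P^*=\mathrm{Hom}_A(P,A)$ carries $(\partial\varphi)(x)=\partial(\varphi(x))-\varphi(\partial x)$. Let $$U^\circ=\Big(\bigoplus_{P} P^*\otimes_{T_P}P\Big)\Big/\big\langle\, \psi\otimes t(p)-(\psi\circ t)\otimes p \;:\; t:P\to Q \text{ a morphism},\ \psi\in Q^*,\ p\in P\,\big\rangle$$ be the finite dual of the first Weyl algebra, and write $\overline{\varphi\otimes p}$ for the class of $\varphi\otimes p$. It is a commutative Hopf algebroid over $(\mathbb{C},A)$ with product $\overline{\varphi\otimes p}\cdot\overline{\psi\otimes q}=\overline{(\psi\star\varphi)\otimes(q\otimes p)}$, where $(\psi\star\varphi)(y\otimes x)=\psi(y)\varphi(x)$; structure map $A\otimes_{\mathbb{C}}A\to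 U^\circ$, $a\otimes b\mapsto\overline{l_a\otimes b}$, formed on the differential module $(A,\partial)$ with $l_a(x)=ax$; comultiplication $\Delta(\overline{\varphi\otimes p})=\sum_i\overline{\varphi\otimes e_i}\otimes_A\overline{e_i^*\otimes p}$ for any basis $(e_i)$ of $P$ with dual basis $(e_i^*)$; counit $\varepsilon(\overline{\varphi\otimes p})=\varphi(p)$; and antipode $\mathscr{S}(\overline{\varphi\otimes p})=\overline{\mathrm{ev}_p\otimes\varphi}$, formed on $P^*$. A sub-bialgebroid (respectively Hopf subalgebroid) of $U^\circ$ is an $(A\otimes_{\mathbb{C}}A)$-subalgebra that carries a structure of commutative bialgebroid (respectively commutative Hopf algebroid) for which the inclusion into $U^\circ$ is a morphism of bialgebroids (respectively Hopf algebroids). **Proposition.** Let $M$ be a differential module of rank $m$ with basis $e_1,\dots,e_m$ and dual basis $e_1^*,\dots,e_m^*$. Let $U^\circ_M\subseteq U^\circ$ be the $(A\otimes_{\mathbb{C}}A)$-subalgebra generated by the image of $M^*\otimes M$, put $u_{ij}=\overline{e_i^*\otimes e_j}$, and let $$\mathrm{det}_M=\overline{(e_m^*\star\cdots\star e_1^*)\otimes\sum_{\sigma\in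 S_m}\mathrm{sgn}(\sigma)\,e_{\sigma(m)}\otimes\cdots\otimes e_{\sigma(1)}}\in U^\circ,$$ formed on the differential module $M^{\otimes m}$, where $(e_m^*\star\cdots\star e_1^*)(x_m\otimes\cdots\otimes x_1)=e_m^*(x_m)\cdots e_1^*(x_1)$. Then: 1. $U^\circ_M$ is a sub-bialgebroid of $U^\circ$. 2. $\mathrm{det}_M\in U^\circ_M$, and $\mathrm{det}_M$ is invertible in $U^\circ$. Let $U^\circ_M[\mathrm{det}_M^{-1}]$ be the $(A\otimes_{\mathbb{C}}A)$-subalgebra of $U^\circ$ generated by $U^\circ_M$ and $\mathrm{det}_M^{-1}$; it is the localization of $U^\circ_M$ at the powers of $\mathrm{det}_M$. 3. $U^\circ_M[\mathrm{det}_M^{-1}]$ is a Hopf subalgebroid of $U^\circ$. 4. Its antipode is determined by $\mathscr{S}(u_{ij})=\mathrm{det}_M^{-1}v_{ji}$ for all $i,j$, where $v_{ji}$ is the $(j,i)$ cofactor of the matrix $(u_{ij})$, that is, $(-1)^{i+j}$ times the determinant of the matrix obtained by deleting row $j$ and column $i$, together with $\mathscr{S}(\mathrm{det}_M)=\mathrm{det}_M^{-1}$.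 -/

import Mathlib

open scoped TensorProduct

namespace FinDual

section Bialgebroids

universe u v w x

/-- A copy of the ring `H`, viewed as an `A`-algebra through the ring map `f : A → H`. -/
def Via {A : Type u} {H : Type v} [CommRing A] [CommRing H] (_f : A →+* H) : Type v := H

instance {A : Type u} {H : Type v} [CommRing A] [CommRing H] (f : A →+* H) :
    CommRing (Via f) := inferInstanceAs (CommRing H)

instance {A : Type u} {H : Type v} [CommRing A] [CommRing H] (f : A →+* H) :
    Algebra A (Via f) := RingHom.toAlgebra (S := Via f) f

/-- The tensor product `B ⊗_A C`, where `A` acts on `B` through `β` and on `C` through `γ`. -/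
abbrev BT {A : Type u} {B : Type v} {C : Type w} [CommRing A] [CommRing B] [CommRing C]
    (β : A →+* B) (γ : A →+* C) : Type (max v w) := Via β ⊗[A] Via γ

variable {A : Type u} {B : Type v} {C : Type w} [CommRing A] [CommRing B] [CommRing C]

/-- `b ↦ b ⊗ 1`. -/
def inl (β : A →+* B) (γ : A →+* C) : B →+* BT β γ :=
  (Algebra.TensorProduct.includeLeftRingHom : Via β →+* Via β ⊗[A] Via γ)

/-- `c ↦ 1 ⊗ c`. -/
def inr (β : A →+* B) (γ : A →+* C) : C →+* BT β γ :=
  (Algebra.TensorProduct.includeRight : Via γ →ₐ[A] Via β ⊗[A] Via γ).toRingHom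

theorem inl_eq_inr (β : A →+* B) (γ : A →+* C) (a : A) :
    inl β γ (β a) = inr β γ (γ a) :=
  Algebra.TensorProduct.tmul_one_eq_one_tmul (A := Via β) (B := Via γ) a

/-- The ring map `b ⊗ c ↦ f b * g c`. -/
def BTlift {D : Type x} [CommRing D] (β : A →+* B) (γ : A →+* C) (f : B →+* D) (g : C →+* D)
    (h : ∀ a, f (β a) = g (γ a)) : BT β γ →+* D :=
  letI : Algebra A D := (f.comp β).toAlgebra
  (Algebra.TensorProduct.lift
    ({ (f : Via β →+* D) with commutes' := fun _ => rfl } : Via β →ₐ[A] D)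
    ({ (g : Via γ →+* D) with commutes' := fun a => (h a).symm } : Via γ →ₐ[A] D)
    (fun _ _ => Commute.all _ _)).toRingHom

theorem BTlift_inl {D : Type x} [CommRing D] (β : A →+* B) (γ : A →+* C) (f : B →+* D)
    (g : C →+* D) (h : ∀ a, f (β a) = g (γ a)) (b : B) :
    BTlift β γ f g h (inl β γ b) = f b := by
  change f b * g 1 = f b
  rw [map_one, mul_one]

theorem BTlift_inr {D : Type x} [CommRing D] (β : A →+* B) (γ : A →+* C) (f : B →+* D)
    (g : C →+* D) (h : ∀ a, f (β a) = g (γ a)) (c : C) :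
    BTlift β γ f g h (inr β γ c) = g c := by
  change f 1 * g c = g c
  rw [map_one, one_mul]

/-- The source map `a ↦ η(a ⊗ 1)` of an `(A ⊗ A)`-algebra. -/
def srcMap (K : Type u) (A : Type v) (H : Type w) [CommRing K] [CommRing A] [Algebra K A]
    [CommRing H] [Algebra (A ⊗[K] A) H] : A →+* H :=
  (algebraMap (A ⊗[K] A) H).comp Algebra.TensorProduct.includeLeftRingHom

/-- The target map `a ↦ η(1 ⊗ a)` of an `(A ⊗ A)`-algebra. -/
def tgtMap (K : Type u) (A : Type v) (H : Type w) [CommRing K] [CommRing A] [Algebra K A]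
    [CommRing H] [Algebra (A ⊗[K] A) H] : A →+* H :=
  (algebraMap (A ⊗[K] A) H).comp
    (Algebra.TensorProduct.includeRight : A →ₐ[K] A ⊗[K] A).toRingHom

/-- `H ⊗_A H` for an `(A ⊗ A)`-algebra `H`: the left factor is an `A`-module through the target
(the right action of `A`), the right factor through the source (the left action of `A`). -/
abbrev HH (K : Type u) (A : Type v) (H : Type w) [CommRing K] [CommRing A] [Algebra K A]
    [CommRing H] [Algebra (A ⊗[K] A) H] : Type w :=
  BT (tgtMap K A H) (srcMap K A H)

/-- `x ↦ x ⊗ 1` into `H ⊗_A H`. -/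
abbrev fst (K : Type u) (A : Type v) (H : Type w) [CommRing K] [CommRing A] [Algebra K A]
    [CommRing H] [Algebra (A ⊗[K] A) H] : H →+* HH K A H :=
  inl (tgtMap K A H) (srcMap K A H)

/-- `x ↦ 1 ⊗ x` into `H ⊗_A H`. -/
abbrev snd (K : Type u) (A : Type v) (H : Type w) [CommRing K] [CommRing A] [Algebra K A]
    [CommRing H] [Algebra (A ⊗[K] A) H] : H →+* HH K A H :=
  inr (tgtMap K A H) (srcMap K A H)

/-- `H ⊗_A H ⊗_A H`, bracketed as `(H ⊗_A H) ⊗_A H`. -/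
abbrev HHH (K : Type u) (A : Type v) (H : Type w) [CommRing K] [CommRing A] [Algebra K A]
    [CommRing H] [Algebra (A ⊗[K] A) H] : Type w :=
  BT ((snd K A H).comp (tgtMap K A H)) (srcMap K A H)

/-- `x ⊗ y ↦ x ⊗ y ⊗ 1`. -/
abbrev fst₃ (K : Type u) (A : Type v) (H : Type w) [CommRing K] [CommRing A] [Algebra K A]
    [CommRing H] [Algebra (A ⊗[K] A) H] : HH K A H →+* HHH K A H :=
  inl ((snd K A H).comp (tgtMap K A H)) (srcMap K A H)

/-- `z ↦ 1 ⊗ 1 ⊗ z`. -/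
abbrev snd₃ (K : Type u) (A : Type v) (H : Type w) [CommRing K] [CommRing A] [Algebra K A]
    [CommRing H] [Algebra (A ⊗[K] A) H] : H →+* HHH K A H :=
  inr ((snd K A H).comp (tgtMap K A H)) (srcMap K A H)

/-- `y ⊗ z ↦ 1 ⊗ y ⊗ z`. -/
def tail₃ (K : Type u) (A : Type v) (H : Type w) [CommRing K] [CommRing A] [Algebra K A]
    [CommRing H] [Algebra (A ⊗[K] A) H] : HH K A H →+* HHH K A H :=
  BTlift (tgtMap K A H) (srcMap K A H) ((fst₃ K A H).comp (snd K A H)) (snd₃ K A H)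
    (fun a => inl_eq_inr ((snd K A H).comp (tgtMap K A H)) (srcMap K A H) a)

/-- A commutative bialgebroid `(A, H)` over `K`: a commutative `(A ⊗_K A)`-algebra `H` with an
`A`-coring structure on the bimodule `H` (left action through the source, right action through
the target) whose comultiplication and counit are ring maps. -/
structure CommBialgebroid (K : Type u) (A : Type v) (H : Type w) [CommRing K] [CommRing A]
    [Algebra K A] [CommRing H] [Algebra (A ⊗[K] A) H] where
  comul : H →+* HH K A H
  counit : H →+* A
  comul_src : ∀ a, comul (srcMap K A H a) = fst K A H (srcMap K A H a)
  comul_tgt : ∀ a, comul (tgtMap K A H a) = snd K A H (tgtMap K A H a)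
  counit_src : ∀ a, counit (srcMap K A H a) = a
  counit_tgt : ∀ a, counit (tgtMap K A H a) = a
  /-- `ε(h₁) h₂ = h` -/
  counit_left : ∀ h, BTlift (tgtMap K A H) (srcMap K A H) ((srcMap K A H).comp counit)
    (RingHom.id H) (fun a => congrArg (srcMap K A H) (counit_tgt a)) (comul h) = h
  /-- `h₁ ε(h₂) = h` -/
  counit_right : ∀ h, BTlift (tgtMap K A H) (srcMap K A H) (RingHom.id H)
    ((tgtMap K A H).comp counit)
    (fun a => (congrArg (tgtMap K A H) (counit_src a)).symm) (comul h) = h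
  /-- `(Δ ⊗ id) Δ = (id ⊗ Δ) Δ` -/
  coassoc : ∀ h,
    BTlift (tgtMap K A H) (srcMap K A H) ((fst₃ K A H).comp comul) (snd₃ K A H)
      (fun a => (congrArg (fst₃ K A H) (comul_tgt a)).trans
        (inl_eq_inr ((snd K A H).comp (tgtMap K A H)) (srcMap K A H) a)) (comul h) =
    BTlift (tgtMap K A H) (srcMap K A H) ((fst₃ K A H).comp (fst K A H))
      ((tail₃ K A H).comp comul)
      (fun a => (congrArg (fst₃ K A H) (inl_eq_inr (tgtMap K A H) (srcMap K A H) a)).trans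
        ((congrArg (tail₃ K A H) (comul_src a)).trans
          (BTlift_inl (tgtMap K A H) (srcMap K A H) _ _ _ (srcMap K A H a))).symm)
      (comul h)

/-- A commutative Hopf algebroid `(A, H)` over `K`: a commutative bialgebroid with an
antipode. -/
structure CommHopfAlgebroid (K : Type u) (A : Type v) (H : Type w) [CommRing K] [CommRing A]
    [Algebra K A] [CommRing H] [Algebra (A ⊗[K] A) H] extends CommBialgebroid K A H where
  antipode : H →+* H
  antipode_src : ∀ a, antipode (srcMap K A H a) = tgtMap K A H a
  antipode_tgt : ∀ a, antipode (tgtMap K A H a) = srcMap K A H a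
  antipode_antipode : ∀ h, antipode (antipode h) = h
  /-- `h₁ S(h₂) = s(ε(h))` -/
  mul_antipode : ∀ h, BTlift (tgtMap K A H) (srcMap K A H) (RingHom.id H) antipode
    (fun a => (antipode_src a).symm) (comul h) = srcMap K A H (counit h)
  /-- `S(h₁) h₂ = t(ε(h))` -/
  antipode_mul : ∀ h, BTlift (tgtMap K A H) (srcMap K A H) antipode (RingHom.id H)
    antipode_tgt (comul h) = tgtMap K A H (counit h)

variable {K : Type u} {A : Type v} {H : Type w} [CommRing K] [CommRing A] [Algebra K A]
  [CommRing H] [Algebra (A ⊗[K] A) H]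

/-- The map `V ⊗_A V → H ⊗_A H` induced by the inclusion of a subalgebra. -/
def inclTensor (V : Subalgebra (A ⊗[K] A) H) : HH K A V →+* HH K A H :=
  BTlift (tgtMap K A V) (srcMap K A V) ((fst K A H).comp V.val.toRingHom)
    ((snd K A H).comp V.val.toRingHom)
    (fun a => inl_eq_inr (tgtMap K A H) (srcMap K A H) a)

/-- The `(A ⊗ A)`-subalgebra `V` is a sub-bialgebroid of `H`: it carries a bialgebroid structure
for which the inclusion is a morphism of bialgebroids. -/
def IsSubBialgebroid (h : CommBialgebroid K A H) (V : Subalgebra (A ⊗[K] A) H) : Prop :=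
  ∃ k : CommBialgebroid K A V,
    (∀ v, inclTensor V (k.comul v) = h.comul v) ∧ (∀ v, k.counit v = h.counit v)

/-- The `(A ⊗ A)`-subalgebra `V` is a Hopf subalgebroid of `H`: it carries a Hopf algebroid
structure for which the inclusion is a morphism of Hopf algebroids. -/
def IsHopfSubalgebroid (h : CommHopfAlgebroid K A H) (V : Subalgebra (A ⊗[K] A) H) : Prop :=
  ∃ k : CommHopfAlgebroid K A V,
    (∀ v, inclTensor V (k.comul v) = h.comul v) ∧ (∀ v, k.counit v = h.counit v) ∧
      (∀ v, (k.antipode v : H) = h.antipode v)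

end Bialgebroids


/-- The coordinate ring `A = ℂ[X]` of the affine line. -/
abbrev A : Type := Polynomial ℂ

/-- The derivation `∂ = d/dX` of `A`. -/
noncomputable def der (a : A) : A := Polynomial.derivative a

theorem der_add (a b : A) : der (a + b) = der a + der b := by simp [der]

theorem der_mul (a b : A) : der (a * b) = der a * b + a * der b := by simp [der]

theorem der_C (c : ℂ) : der (Polynomial.C c) = 0 := by simp [der]

theorem der_one : der 1 = 0 := by simp [der]

/-- A differential module over `(A, ∂)`: a finitely generated `A`-module with an additive
map `d` satisfying the Leibniz rule.  Since constants have derivative zero, `d` is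
automatically `ℂ`-linear.  These are exactly the right modules over the first Weyl algebra
`A[Y, ∂]` (with `x * Y = d x`) that are finitely generated over `A`; their underlying
`A`-modules are automatically free (see `DiffMod.free` below). -/
structure DiffMod : Type 1 where
  carrier : Type
  [grp : AddCommGroup carrier]
  [mod : Module A carrier]
  [fin : Module.Finite A carrier]
  d : carrier →+ carrier
  leibniz : ∀ (a : A) (x : carrier), d (a • x) = a • d x + der a • x

instance : CoeSort DiffMod Type := ⟨DiffMod.carrier⟩

attribute [instance] DiffMod.grp DiffMod.mod DiffMod.fin

/-- The torsion submodule of a differential module is zero. -/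
theorem DiffMod.torsion_eq_bot (P : DiffMod) : Submodule.torsion A P = ⊥ := by
  have hd : ∀ x ∈ Submodule.torsion A P, P.d x ∈ Submodule.torsion A P := by
    intro x hx
    rw [Submodule.mem_torsion_iff] at hx ⊢
    obtain ⟨⟨a, ha⟩, hax⟩ := hx
    refine ⟨⟨a * a, mul_mem ha ha⟩, ?_⟩
    have hax' : a • x = 0 := hax
    have h := P.leibniz a x
    rw [hax', map_zero] at h
    change (a * a) • P.d x = 0
    have h2 := congrArg (fun y => a • y) h
    simp only [smul_zero, smul_add, smul_smul] at h2
    rw [mul_comm a (der a), ← smul_smul (der a) a x, hax', smul_zero, add_zero] at h2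
    exact h2.symm
  have hT : Module.IsTorsion A (Submodule.torsion A P) := by
    exact Submodule.torsion_isTorsion
  obtain ⟨f, hf, hf0⟩ := Submodule.annihilator_top_inter_nonZeroDivisors hT
  have key : ∀ n : ℕ, ∀ f : A, f.natDegree = n → f ≠ 0 →
      (∀ x ∈ Submodule.torsion A P, f • x = 0) → Submodule.torsion A P = ⊥ := by
    intro n
    induction n using Nat.strong_induction_on with
    | _ n ih =>
      intro f hn hf hann
      have hann' : ∀ x ∈ Submodule.torsion A P, der f • x = 0 := by
        intro x hx
        have h := P.leibniz f x
        rw [hann x hx, map_zero, hann _ (hd x hx), zero_add] at h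
        exact h.symm
      by_cases h0 : f.natDegree = 0
      · obtain ⟨c, hc⟩ := Polynomial.natDegree_eq_zero.mp h0
        have hc0 : c ≠ 0 := by
          rintro rfl
          exact hf (by rw [← hc, map_zero])
        rw [eq_bot_iff]
        intro x hx
        have h := hann x hx
        rw [← hc] at h
        have h2 := congrArg (fun y => (Polynomial.C c⁻¹ : A) • y) h
        simp only [smul_smul, smul_zero, ← Polynomial.C_mul, inv_mul_cancel₀ hc0,
          Polynomial.C_1, one_smul] at h2
        exact (Submodule.mem_bot A).mpr h2
      · have hlt : (der f).natDegree < n := by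
          rw [← hn]
          exact Polynomial.natDegree_derivative_lt h0
        refine ih _ hlt (der f) rfl ?_ hann'
        intro hz
        exact h0 (Polynomial.derivative_eq_zero.mp hz)
  refine key _ f rfl (nonZeroDivisors.ne_zero hf0) ?_
  intro x hx
  have := Submodule.mem_annihilator.mp hf ⟨x, hx⟩ trivial
  simpa using congrArg Subtype.val this

/-- Every differential module is free as an `A`-module. -/
instance DiffMod.free (P : DiffMod) : Module.Free A P := by
  have : Module.IsTorsionFree A P :=
    Submodule.isTorsionFree_iff_torsion_eq_bot.mpr P.torsion_eq_bot
  exact Module.free_of_finite_type_torsion_free'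

/-- The `A`-linear dual `P* = Hom_A(P, A)`. -/
abbrev Dl (P : DiffMod) : Type := Module.Dual A P

/-- Morphisms of differential modules: `A`-linear maps commuting with the differentials. -/
def IsHom {P Q : DiffMod} (t : P →ₗ[A] Q) : Prop := ∀ x, t (P.d x) = Q.d (t x)

/-- The unit object `(A, ∂)`. -/
noncomputable def unitObj : DiffMod where
  carrier := A
  d := AddMonoidHom.mk' der der_add
  leibniz a x := by
    change der (a * x) = a * der x + der a * x
    rw [der_mul, add_comm]

/-- The tensor product `P ⊗_A Q`, with `∂(x ⊗ y) = ∂x ⊗ y + x ⊗ ∂y`. -/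
noncomputable def tens (P Q : DiffMod) : DiffMod where
  carrier := P ⊗[A] Q
  d := TensorProduct.liftAddHom
    (AddMonoidHom.mk' (fun x : P => AddMonoidHom.mk'
        (fun y : Q => P.d x ⊗ₜ[A] y + x ⊗ₜ[A] Q.d y)
        (fun y z => by simp only [TensorProduct.tmul_add, map_add]; abel))
      (fun x z => by
        ext y
        simp only [AddMonoidHom.mk'_apply, AddMonoidHom.add_apply, map_add,
          TensorProduct.add_tmul]
        abel))
    (fun a x y => by
      simp only [AddMonoidHom.mk'_apply, P.leibniz, Q.leibniz, TensorProduct.add_tmul,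
        TensorProduct.tmul_add, TensorProduct.smul_tmul]
      abel)
  leibniz a z := by
    induction z using TensorProduct.induction_on with
    | zero => simp
    | tmul x y =>
      rw [TensorProduct.smul_tmul', TensorProduct.liftAddHom_tmul,
        TensorProduct.liftAddHom_tmul]
      simp only [AddMonoidHom.mk'_apply, P.leibniz, TensorProduct.add_tmul, smul_add,
        TensorProduct.smul_tmul']
      abel
    | add x y hx hy => simp only [smul_add, map_add, hx, hy]; abel

/-- The dual differential module, with `(∂φ)(x) = ∂(φ x) - φ (∂ x)`. -/
noncomputable def dualObj (P : DiffMod) : DiffMod where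
  carrier := Dl P
  d := AddMonoidHom.mk' (fun φ : Dl P =>
      { toFun := fun x => der (φ x) - φ (P.d x)
        map_add' := fun x y => by simp only [map_add, der_add]; ring
        map_smul' := fun a x => by
          simp only [map_smul, P.leibniz, map_add, smul_eq_mul, der_mul, RingHom.id_apply]
          ring })
    (fun φ ψ => by
      refine LinearMap.ext fun x => ?_
      change der (φ x + ψ x) - (φ (P.d x) + ψ (P.d x)) =
        (der (φ x) - φ (P.d x)) + (der (ψ x) - ψ (P.d x))
      rw [der_add]; ring)
  leibniz a φ := by
    refine LinearMap.ext fun x => ?_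
    change der (a * φ x) - a * φ (P.d x) = a * (der (φ x) - φ (P.d x)) + der a * φ x
    rw [der_mul]; ring

/-- The simple tensor `x ⊗ y` as an element of the object `tens P Q`. -/
noncomputable def tm {P Q : DiffMod} (x : P) (y : Q) : tens P Q := x ⊗ₜ[A] y

/-- The functional `φ ⋆ ψ : P ⊗_A Q → A`, `x ⊗ y ↦ ψ (φ(x) y)`. -/
noncomputable def star {P Q : DiffMod} (φ : Dl P) (ψ : Dl Q) : Dl (tens P Q) :=
  TensorProduct.lift (LinearMap.mk₂ A (fun (x : P) (y : Q) => ψ (φ x • y))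
    (fun x x' y => by simp only [map_add, add_smul])
    (fun a x y => by simp only [map_smul, smul_eq_mul]; ring)
    (fun x y y' => by simp only [map_add, smul_add])
    (fun a x y => by simp only [map_smul, smul_eq_mul]; ring))

theorem tens_d {P Q : DiffMod} (x : P) (y : Q) :
    (tens P Q).d (tm x y) = tm (P.d x) y + tm x (Q.d y) := rfl

theorem star_tm {P Q : DiffMod} (φ : Dl P) (ψ : Dl Q) (x : P) (y : Q) :
    star φ ψ (tm x y) = φ x * ψ y := by
  change ψ (φ x • y) = _
  rw [map_smul, smul_eq_mul]

theorem tm_add_left {P Q : DiffMod} (x x' : P) (y : Q) :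
    tm (x + x') y = tm x y + tm x' y := TensorProduct.add_tmul x x' y

theorem tm_add_right {P Q : DiffMod} (x : P) (y y' : Q) :
    tm x (y + y') = tm x y + tm x y' := TensorProduct.tmul_add x y y'

theorem tm_smul_left {P Q : DiffMod} (a : A) (x : P) (y : Q) :
    tm (a • x) y = a • tm x y := rfl

theorem tm_smul_right {P Q : DiffMod} (a : A) (x : P) (y : Q) :
    tm x (a • y) = a • tm x y := TensorProduct.tmul_smul a x y

theorem tens_induction {P Q : DiffMod} {C : tens P Q → Prop} (h0 : C 0)
    (ht : ∀ x y, C (tm x y)) (ha : ∀ u v, C u → C v → C (u + v)) (z : tens P Q) : C z :=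
  TensorProduct.induction_on z h0 ht ha

theorem tens_ext {P Q : DiffMod} {N : Type*} [AddCommMonoid N] [Module A N]
    {f g : tens P Q →ₗ[A] N} (h : ∀ x y, f (tm x y) = g (tm x y)) : f = g :=
  TensorProduct.ext' h

theorem star_add_left {P Q : DiffMod} (φ φ' : Dl P) (ψ : Dl Q) :
    star (φ + φ') ψ = star φ ψ + star φ' ψ :=
  tens_ext fun x y => by simp only [star_tm, LinearMap.add_apply]; ring

theorem star_add_right {P Q : DiffMod} (φ : Dl P) (ψ ψ' : Dl Q) :
    star φ (ψ + ψ') = star φ ψ + star φ ψ' :=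
  tens_ext fun x y => by simp only [star_tm, LinearMap.add_apply]; ring

/-- `P* ⊗ P`.  Tensoring over `ℤ` here is harmless: the balancing over the endomorphism ring
`T_P` of `P` is among the relations imposed below. -/
abbrev Blk (P : DiffMod) : Type := Dl P ⊗[ℤ] P

noncomputable instance : DecidableEq DiffMod := Classical.decEq _

noncomputable instance (P : DiffMod) : AddCommGroup (Blk P) := inferInstance

/-- The direct sum of the `P* ⊗ P` over all differential modules `P`. -/
abbrev Big : Type 1 := DirectSum DiffMod Blk

noncomputable instance : AddCommGroup Big := inferInstanceAs (AddCommGroup (Π₀ P, Blk P))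

/-- The element `φ ⊗ p` of the summand indexed by `P`. -/
noncomputable def gen (P : DiffMod) (φ : Dl P) (p : P) : Big :=
  DirectSum.of Blk P (φ ⊗ₜ[ℤ] p)

/-- The relations `ψ ⊗ t p = (ψ ∘ t) ⊗ p` for all morphisms `t : P → Q`; the case `P = Q`
is the balancing over `T_P`. -/
noncomputable def rel : AddSubgroup Big :=
  AddSubgroup.closure {z | ∃ (P Q : DiffMod) (t : P →ₗ[A] Q) (_ : IsHom t) (ψ : Dl Q) (p : P),
    z = gen Q ψ (t p) - gen P (ψ ∘ₗ t) p}

/-- The finite dual `U°` of the first Weyl algebra: the infinite comatrix coring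
`(⨁_P P* ⊗_{T_P} P) / J` of the forgetful functor on differential modules. -/
def U : Type 1 := Big ⧸ rel

noncomputable instance : AddCommGroup U := inferInstanceAs (AddCommGroup (Big ⧸ rel))

/-- The class of `φ ⊗_{T_P} p` in `U°`. -/
noncomputable def mk {P : DiffMod} (φ : Dl P) (p : P) : U :=
  (QuotientAddGroup.mk (gen P φ p) : Big ⧸ rel)

theorem mk_add_left {P : DiffMod} (φ φ' : Dl P) (p : P) :
    mk (φ + φ') p = mk φ p + mk φ' p := by
  unfold mk gen
  rw [TensorProduct.add_tmul, map_add]; rfl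

theorem mk_add_right {P : DiffMod} (φ : Dl P) (p p' : P) :
    mk φ (p + p') = mk φ p + mk φ p' := by
  unfold mk gen
  rw [TensorProduct.tmul_add, map_add]; rfl

theorem mk_rel {P Q : DiffMod} (t : P →ₗ[A] Q) (ht : IsHom t) (ψ : Dl Q) (p : P) :
    mk ψ (t p) = mk (ψ ∘ₗ t) p := by
  refine (QuotientAddGroup.eq_iff_sub_mem).mpr ?_
  exact AddSubgroup.subset_closure ⟨P, Q, t, ht, ψ, p, rfl⟩

theorem bal_int {G : Type*} [AddCommGroup G] {P : DiffMod} (f : Dl P →+ P →+ G) (r : ℤ)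
    (φ : Dl P) (p : P) : f (r • φ) p = f φ (r • p) := by
  rw [map_zsmul, map_zsmul]; rfl

/-- The additive map out of `⨁_P P* ⊗ P` given by a family of biadditive maps. -/
noncomputable def liftBig {G : Type*} [AddCommGroup G] (F : ∀ P : DiffMod, Dl P →+ P →+ G) :
    Big →+ G :=
  DirectSum.toAddMonoid fun P => TensorProduct.liftAddHom (F P) (bal_int (F P))

theorem liftBig_gen {G : Type*} [AddCommGroup G] (F : ∀ P : DiffMod, Dl P →+ P →+ G)
    {P : DiffMod} (φ : Dl P) (p : P) : liftBig F (gen P φ p) = F P φ p := by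
  unfold liftBig gen
  rw [DirectSum.toAddMonoid_of, TensorProduct.liftAddHom_tmul]

/-- Universal property of `U°`. -/
noncomputable def lift {G : Type*} [AddCommGroup G] (F : ∀ P : DiffMod, Dl P →+ P →+ G)
    (hF : ∀ (P Q : DiffMod) (t : P →ₗ[A] Q), IsHom t → ∀ (ψ : Dl Q) (p : P),
      F Q ψ (t p) = F P (ψ ∘ₗ t) p) : U →+ G :=
  QuotientAddGroup.lift rel (liftBig F) (by
    rw [rel, AddSubgroup.closure_le]
    rintro z ⟨P, Q, t, ht, ψ, p, rfl⟩
    rw [SetLike.mem_coe, AddMonoidHom.mem_ker, map_sub, liftBig_gen, liftBig_gen,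
      hF P Q t ht, sub_self])

theorem lift_mk {G : Type*} [AddCommGroup G] (F : ∀ P : DiffMod, Dl P →+ P →+ G)
    (hF : ∀ (P Q : DiffMod) (t : P →ₗ[A] Q), IsHom t → ∀ (ψ : Dl Q) (p : P),
      F Q ψ (t p) = F P (ψ ∘ₗ t) p) {P : DiffMod} (φ : Dl P) (p : P) :
    lift F hF (mk φ p) = F P φ p := by
  exact liftBig_gen F φ p

/-- Universal property of `U°`, for plain functions. -/
noncomputable def liftF {G : Type*} [AddCommGroup G] (F : ∀ P : DiffMod, Dl P → P → G)
    (h₁ : ∀ (P : DiffMod) (φ φ' : Dl P) (p : P), F P (φ + φ') p = F P φ p + F P φ' p)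
    (h₂ : ∀ (P : DiffMod) (φ : Dl P) (p p' : P), F P φ (p + p') = F P φ p + F P φ p')
    (h₃ : ∀ (P Q : DiffMod) (t : P →ₗ[A] Q), IsHom t → ∀ (ψ : Dl Q) (p : P),
      F Q ψ (t p) = F P (ψ ∘ₗ t) p) : U →+ G :=
  lift (fun P => AddMonoidHom.mk' (fun φ => AddMonoidHom.mk' (F P φ) (h₂ P φ))
    (fun φ φ' => AddMonoidHom.ext (h₁ P φ φ'))) h₃

theorem liftF_mk {G : Type*} [AddCommGroup G] (F : ∀ P : DiffMod, Dl P → P → G)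
    (h₁ : ∀ (P : DiffMod) (φ φ' : Dl P) (p : P), F P (φ + φ') p = F P φ p + F P φ' p)
    (h₂ : ∀ (P : DiffMod) (φ : Dl P) (p p' : P), F P φ (p + p') = F P φ p + F P φ p')
    (h₃ : ∀ (P Q : DiffMod) (t : P →ₗ[A] Q), IsHom t → ∀ (ψ : Dl Q) (p : P),
      F Q ψ (t p) = F P (ψ ∘ₗ t) p) {P : DiffMod} (φ : Dl P) (p : P) :
    liftF F h₁ h₂ h₃ (mk φ p) = F P φ p := lift_mk _ _ φ p

theorem U_induction {C : U → Prop} (h0 : C 0) (hm : ∀ (P : DiffMod) (φ : Dl P) (p : P), C (mk φ p))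
    (ha : ∀ x y, C x → C y → C (x + y)) (z : U) : C z := by
  obtain ⟨z, rfl⟩ := QuotientAddGroup.mk_surjective (s := rel) z
  have key : ∀ w : Big, C (QuotientAddGroup.mk w : Big ⧸ rel) := by
    intro w
    refine DirectSum.induction_on (β := Blk) (motive := fun w : Big => C (QuotientAddGroup.mk w : Big ⧸ rel)) w
      h0 ?_ (fun x y hx hy => ha _ _ hx hy)
    intro P v
    induction v using TensorProduct.induction_on with
    | zero => rw [map_zero]; exact h0
    | tmul φ p => exact hm P φ p
    | add x y hx hy => rw [map_add]; exact ha _ _ hx hy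
  exact key z

theorem U_hom_ext {G : Type*} [AddCommGroup G] {f g : U →+ G}
    (h : ∀ (P : DiffMod) (φ : Dl P) (p : P), f (mk φ p) = g (mk φ p)) : f = g := by
  ext z
  induction z using U_induction with
  | h0 => simp
  | hm P φ p => exact h P φ p
  | ha x y hx hy => rw [map_add, map_add, hx, hy]


/-- The class map as a biadditive map. -/
noncomputable def mkHom (P : DiffMod) : Dl P →+ P →+ U :=
  AddMonoidHom.mk' (fun φ => AddMonoidHom.mk' (fun p => mk φ p) (mk_add_right φ))
    (fun φ φ' => AddMonoidHom.ext fun p => mk_add_left φ φ' p)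

theorem mkHom_apply {P : DiffMod} (φ : Dl P) (p : P) : mkHom P φ p = mk φ p := rfl

theorem mk_sum_right {P : DiffMod} {ι : Type*} (s : Finset ι) (φ : Dl P) (p : ι → P) :
    mk φ (∑ i ∈ s, p i) = ∑ i ∈ s, mk φ (p i) := map_sum (mkHom P φ) p s

theorem mk_sum_left {P : DiffMod} {ι : Type*} (s : Finset ι) (φ : ι → Dl P) (p : P) :
    mk (∑ i ∈ s, φ i) p = ∑ i ∈ s, mk (φ i) p := by
  rw [← mkHom_apply, map_sum, AddMonoidHom.finsetSum_apply]; rfl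

/-- Two classes related by a morphism `t` agree. -/
theorem mk_eq {P Q : DiffMod} (t : P →ₗ[A] Q) (ht : IsHom t) {φ : Dl P} {ψ : Dl Q} {p : P}
    {q : Q} (hp : t p = q) (hφ : ∀ x, ψ (t x) = φ x) : mk φ p = mk ψ q := by
  rw [← hp, mk_rel t ht]
  congr 1
  exact LinearMap.ext fun x => (hφ x).symm

/-- Linear maps out of `tens P Q`. -/
noncomputable def tlift {P Q : DiffMod} {N : Type*} [AddCommGroup N] [Module A N]
    (f : P →ₗ[A] Q →ₗ[A] N) : tens P Q →ₗ[A] N := TensorProduct.lift f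

theorem tlift_tm {P Q : DiffMod} {N : Type*} [AddCommGroup N] [Module A N]
    (f : P →ₗ[A] Q →ₗ[A] N) (x : P) (y : Q) : tlift f (tm x y) = f x y := rfl

/-- `tm` as a bilinear map. -/
noncomputable def tmL (P Q : DiffMod) : P →ₗ[A] Q →ₗ[A] tens P Q := TensorProduct.mk A P Q

theorem tmL_apply {P Q : DiffMod} (x : P) (y : Q) : tmL P Q x y = tm x y := rfl

theorem isHom_tens {P Q R : DiffMod} (f : tens P Q →ₗ[A] R)
    (h : ∀ x y, f (tm (P.d x) y) + f (tm x (Q.d y)) = R.d (f (tm x y))) : IsHom f := by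
  intro z
  induction z using tens_induction with
  | h0 => simp only [map_zero]
  | ht x y => rw [tens_d, map_add, h]
  | ha u v hu hv => simp only [map_add, hu, hv]

theorem mul_nat_right {P Q Q' : DiffMod} (φ : Dl P) (p : P) (t : Q →ₗ[A] Q') (ht : IsHom t)
    (ψ : Dl Q') (q : Q) : mk (star ψ φ) (tm (t q) p) = mk (star (ψ ∘ₗ t) φ) (tm q p) := by
  symm
  refine mk_eq (tlift ((tmL Q' P) ∘ₗ t)) (isHom_tens _ fun x y => ?_) rfl fun z => ?_
  · simp only [tlift_tm, LinearMap.comp_apply, tmL_apply, tens_d, ht x]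
  · refine LinearMap.congr_fun (f := (star ψ φ) ∘ₗ (tlift ((tmL Q' P) ∘ₗ t)))
      (tens_ext fun x y => ?_) z
    simp only [tlift_tm, LinearMap.comp_apply, tmL_apply, star_tm]

theorem mul_nat_left {P P' Q : DiffMod} (φ : Dl P') (p : P) (t : P →ₗ[A] P') (ht : IsHom t)
    (ψ : Dl Q) (q : Q) : mk (star ψ φ) (tm q (t p)) = mk (star ψ (φ ∘ₗ t)) (tm q p) := by
  symm
  refine mk_eq (tlift ((tmL Q P').compl₂ t)) (isHom_tens _ fun x y => ?_) rfl fun z => ?_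
  · simp only [tlift_tm, LinearMap.compl₂_apply, tmL_apply, tens_d, ht y]
  · refine LinearMap.congr_fun (f := (star ψ φ) ∘ₗ (tlift ((tmL Q P').compl₂ t)))
      (tens_ext fun x y => ?_) z
    simp only [tlift_tm, LinearMap.comp_apply, LinearMap.compl₂_apply, tmL_apply, star_tm]

/-- Multiplication by `[φ ⊗ p]`: `[ψ ⊗ q] ↦ [(ψ ⋆ φ) ⊗ (q ⊗ p)]`. -/
noncomputable def mulMk {P : DiffMod} (φ : Dl P) (p : P) : U →+ U :=
  liftF (fun _ ψ q => mk (star ψ φ) (tm q p))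
    (fun _ _ _ _ => by rw [star_add_left, mk_add_left])
    (fun _ _ _ _ => by rw [tm_add_left, mk_add_right])
    (fun _ _ t ht ψ q => mul_nat_right φ p t ht ψ q)

theorem mulMk_mk {P Q : DiffMod} (φ : Dl P) (p : P) (ψ : Dl Q) (q : Q) :
    mulMk φ p (mk ψ q) = mk (star ψ φ) (tm q p) := liftF_mk _ _ _ _ ψ q

/-- The multiplication of `U°`: `[φ ⊗ p] [ψ ⊗ q] = [(ψ ⋆ φ) ⊗ (q ⊗ p)]`. -/
noncomputable def mulHom : U →+ U →+ U :=
  liftF (fun _ φ p => mulMk φ p)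
    (fun _ _ _ _ => U_hom_ext fun _ _ _ => by
      rw [AddMonoidHom.add_apply, mulMk_mk, mulMk_mk, mulMk_mk, star_add_right, mk_add_left])
    (fun _ _ _ _ => U_hom_ext fun _ _ _ => by
      rw [AddMonoidHom.add_apply, mulMk_mk, mulMk_mk, mulMk_mk, tm_add_right, mk_add_right])
    (fun _ _ t ht φ p => U_hom_ext fun _ ψ q => by
      rw [mulMk_mk, mulMk_mk]; exact mul_nat_left φ p t ht ψ q)

theorem mulHom_mk {P Q : DiffMod} (φ : Dl P) (p : P) (ψ : Dl Q) (q : Q) :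
    mulHom (mk φ p) (mk ψ q) = mk (star ψ φ) (tm q p) := by
  have h : mulHom (mk φ p) = mulMk φ p := liftF_mk _ _ _ _ φ p
  rw [h, mulMk_mk]

/-- The element `a` of the unit object. -/
def el (a : A) : unitObj := a

theorem unit_d (a : A) : unitObj.d (el a) = el (der a) := rfl

theorem smul_el (a b : A) : a • el b = el (a * b) := rfl

theorem unit_cases {C : unitObj → Prop} (h : ∀ a, C (el a)) (x : unitObj) : C x := h x

/-- The functional `l_a : x ↦ a x` on the unit object. -/
noncomputable def lmul (a : A) : Dl unitObj := LinearMap.mulLeft A a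

theorem lmul_el (a b : A) : lmul a (el b) = a * b := rfl

theorem unit_ext {N : Type*} [AddCommMonoid N] [Module A N] {f g : unitObj →ₗ[A] N}
    (h : f (el 1) = g (el 1)) : f = g := by
  refine LinearMap.ext fun x => ?_
  induction x using unit_cases with | h a => ?_
  have ha : el a = a • el 1 := by rw [smul_el, mul_one]
  rw [ha, map_smul, map_smul, h]

/-- The isomorphism `P ⊗ A → P`, `x ⊗ a ↦ a x`. -/
noncomputable def trid (P : DiffMod) : tens P unitObj →ₗ[A] P :=
  tlift ((LinearMap.lsmul A P).flip : P →ₗ[A] A →ₗ[A] P)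

theorem trid_tm {P : DiffMod} (x : P) (a : A) : trid P (tm x (el a)) = a • x := rfl

theorem isHom_trid (P : DiffMod) : IsHom (trid P) := by
  refine isHom_tens _ fun x a => ?_
  induction a using unit_cases with | h a => ?_
  rw [unit_d, trid_tm, trid_tm, trid_tm, P.leibniz]

theorem mulHom_comm (x y : U) : mulHom x y = mulHom y x := by
  induction x using U_induction with
  | h0 => simp only [map_zero, AddMonoidHom.zero_apply]
  | ha x x' hx hx' => simp only [map_add, AddMonoidHom.add_apply, hx, hx']
  | hm P φ p =>
    induction y using U_induction with
    | h0 => simp only [map_zero, AddMonoidHom.zero_apply]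
    | ha x x' hx hx' => simp only [map_add, AddMonoidHom.add_apply, hx, hx']
    | hm Q ψ q =>
      rw [mulHom_mk, mulHom_mk]
      refine mk_eq (tlift (tmL P Q).flip) (isHom_tens _ fun x y => ?_) rfl fun z => ?_
      · simp only [tlift_tm, LinearMap.flip_apply, tmL_apply, tens_d]
        abel
      · refine LinearMap.congr_fun (f := (star φ ψ) ∘ₗ (tlift (tmL P Q).flip))
          (tens_ext fun x y => ?_) z
        simp only [tlift_tm, LinearMap.comp_apply, LinearMap.flip_apply, tmL_apply, star_tm]
        ring

/-- The associativity isomorphism `P ⊗ (Q ⊗ R) → (P ⊗ Q) ⊗ R`. -/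
noncomputable def tassoc (P Q R : DiffMod) : tens P (tens Q R) →ₗ[A] tens (tens P Q) R :=
  ((TensorProduct.assoc A P Q R).symm : P ⊗[A] (Q ⊗[A] R) →ₗ[A] (P ⊗[A] Q) ⊗[A] R)

theorem tassoc_tm {P Q R : DiffMod} (x : P) (y : Q) (z : R) :
    tassoc P Q R (tm x (tm y z)) = tm (tm x y) z := rfl

theorem isHom_tassoc (P Q R : DiffMod) : IsHom (tassoc P Q R) := by
  refine isHom_tens _ fun x w => ?_
  induction w using tens_induction with
  | h0 =>
    have h : ∀ x' : P, tm x' (0 : tens Q R) = 0 := fun x' => TensorProduct.tmul_zero _ x'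
    simp only [map_zero, h, add_zero]
  | ha u v hu hv =>
    simp only [tm_add_right, map_add] at hu hv ⊢
    rw [← hu, ← hv]; abel
  | ht y z =>
    simp only [tens_d, tm_add_right, tm_add_left, map_add, tassoc_tm]
    abel

theorem mulHom_assoc (x y z : U) : mulHom (mulHom x y) z = mulHom x (mulHom y z) := by
  induction x using U_induction with
  | h0 => simp only [map_zero, AddMonoidHom.zero_apply]
  | ha x x' hx hx' => simp only [map_add, AddMonoidHom.add_apply, hx, hx']
  | hm P φ p =>
    induction y using U_induction with
    | h0 => simp only [map_zero, AddMonoidHom.zero_apply]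
    | ha x x' hx hx' => simp only [map_add, AddMonoidHom.add_apply, hx, hx']
    | hm Q ψ q =>
      induction z using U_induction with
      | h0 => simp only [map_zero]
      | ha x x' hx hx' => simp only [map_add, hx, hx']
      | hm R χ r =>
        simp only [mulHom_mk]
        refine mk_eq (tassoc R Q P) (isHom_tassoc R Q P) (tassoc_tm r q p) fun w => ?_
        refine LinearMap.congr_fun (f := (star (star χ ψ) φ) ∘ₗ tassoc R Q P)
          (tens_ext fun x w => ?_) w
        induction w using tens_induction with
        | h0 =>
          have h : tm x (0 : tens Q P) = 0 := TensorProduct.tmul_zero _ x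
          simp only [h, map_zero]
        | ha u v hu hv => simp only [tm_add_right, map_add, hu, hv]
        | ht y z =>
          rw [LinearMap.comp_apply, tassoc_tm]
          simp only [star_tm]; ring

theorem one_mulHom (x : U) : mulHom (mk (lmul 1) (el 1)) x = x := by
  induction x using U_induction with
  | h0 => rw [map_zero]
  | ha x x' hx hx' => rw [map_add, hx, hx']
  | hm P φ p =>
    rw [mulHom_mk]
    refine mk_eq (trid P) (isHom_trid P) ?_ fun z => ?_
    · rw [trid_tm, one_smul]
    · refine LinearMap.congr_fun (f := φ ∘ₗ trid P) (tens_ext fun x a => ?_) z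
      induction a using unit_cases with | h a => ?_
      rw [star_tm, lmul_el, one_mul, LinearMap.comp_apply, trid_tm, map_smul, smul_eq_mul,
        mul_comm]

noncomputable instance : CommRing U :=
  { (inferInstance : AddCommGroup U) with
    mul := fun x y => mulHom x y
    one := mk (lmul 1) (el 1)
    mul_assoc := mulHom_assoc
    mul_comm := mulHom_comm
    one_mul := one_mulHom
    mul_one := fun x => (mulHom_comm _ _).trans (one_mulHom x)
    left_distrib := fun x y z => map_add (mulHom x) y z
    right_distrib := fun x y z => by
      change mulHom (x + y) z = mulHom x z + mulHom y z
      rw [map_add, AddMonoidHom.add_apply]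
    zero_mul := fun x => by
      change mulHom 0 x = 0
      rw [map_zero, AddMonoidHom.zero_apply]
    mul_zero := fun x => map_zero (mulHom x) }

theorem mk_mul {P Q : DiffMod} (φ : Dl P) (p : P) (ψ : Dl Q) (q : Q) :
    mk φ p * mk ψ q = mk (star ψ φ) (tm q p) := mulHom_mk φ p ψ q

theorem one_def : (1 : U) = mk (lmul 1) (el 1) := rfl

theorem unit_mul {P : DiffMod} (a b : A) (φ : Dl P) (p : P) :
    mk (lmul a) (el b) * mk φ p = mk (a • φ) (b • p) := by
  rw [mk_mul]
  refine mk_eq (trid P) (isHom_trid P) (trid_tm p b) fun z => ?_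
  refine LinearMap.congr_fun (f := (a • φ) ∘ₗ trid P) (tens_ext fun x c => ?_) z
  induction c using unit_cases with | h c => ?_
  rw [star_tm, lmul_el, LinearMap.comp_apply, trid_tm, map_smul, LinearMap.smul_apply,
    smul_eq_mul, smul_eq_mul]
  ring

theorem smul_lmul (a b : A) : a • lmul b = lmul (a * b) :=
  unit_ext (by rw [LinearMap.smul_apply, lmul_el, lmul_el, smul_eq_mul, mul_assoc])

/-- The source map `s(a) = [l_a ⊗ 1]` of `U°`. -/
noncomputable def src : A →+* U where
  toFun a := mk (lmul a) (el 1)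
  map_one' := rfl
  map_zero' := by
    have h : lmul 0 = 0 := unit_ext (by rw [lmul_el, zero_mul]; rfl)
    rw [h]; exact congrFun (congrArg DFunLike.coe (map_zero (mkHom unitObj))) _
  map_add' a b := by
    rw [← mk_add_left]
    congr 1
    exact unit_ext (add_mul a b 1)
  map_mul' a b := by rw [unit_mul, one_smul, smul_lmul]

/-- The target map `t(b) = [l_1 ⊗ b]` of `U°`. -/
noncomputable def tgt : A →+* U where
  toFun b := mk (lmul 1) (el b)
  map_one' := rfl
  map_zero' := map_zero (mkHom unitObj (lmul 1))
  map_add' a b := mk_add_right (lmul 1) (el a) (el b)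
  map_mul' a b := by
    rw [unit_mul, one_smul, smul_el]

theorem src_mul_mk {P : DiffMod} (a : A) (φ : Dl P) (p : P) :
    src a * mk φ p = mk (a • φ) p := by
  change mk (lmul a) (el 1) * _ = _
  rw [unit_mul, one_smul]

theorem tgt_mul_mk {P : DiffMod} (b : A) (φ : Dl P) (p : P) :
    tgt b * mk φ p = mk φ (b • p) := by
  change mk (lmul 1) (el b) * _ = _
  rw [unit_mul, one_smul]

theorem src_C (c : ℂ) : src (Polynomial.C c) = tgt (Polynomial.C c) := by
  change mk (lmul _) (el 1) = mk (lmul 1) (el _)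
  refine mk_eq (LinearMap.lsmul A unitObj (Polynomial.C c)) (fun x => ?_) ?_ fun x => ?_
  · induction x using unit_cases with | h a => ?_
    simp only [LinearMap.lsmul_apply, unit_d, smul_el, der_mul, der_C, zero_mul, zero_add]
  · rw [LinearMap.lsmul_apply, smul_el, mul_one]
  · induction x using unit_cases with | h a => ?_
    rw [LinearMap.lsmul_apply, smul_el, lmul_el, lmul_el, one_mul]

noncomputable instance : Algebra ℂ U := (src.comp Polynomial.C).toAlgebra

/-- The structure map `η : A ⊗_ℂ A → U°`, `a ⊗ b ↦ [l_a ⊗ b]`. -/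
noncomputable def eta : A ⊗[ℂ] A →+* U :=
  (Algebra.TensorProduct.lift
    ({ src with commutes' := fun _ => rfl } : A →ₐ[ℂ] U)
    ({ tgt with commutes' := fun c => (src_C c).symm } : A →ₐ[ℂ] U)
    (fun _ _ => Commute.all _ _)).toRingHom

theorem eta_tmul (a b : A) : eta (a ⊗ₜ[ℂ] b) = mk (lmul a) (el b) := by
  change src a * tgt b = _
  change mk (lmul a) (el 1) * mk (lmul 1) (el b) = _
  rw [unit_mul, one_smul, smul_lmul, mul_one]

noncomputable instance : Algebra (A ⊗[ℂ] A) U := eta.toAlgebra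

theorem srcMap_eq (a : A) : srcMap ℂ A U a = src a := by
  change src a * tgt 1 = _
  rw [map_one, mul_one]

theorem tgtMap_eq (a : A) : tgtMap ℂ A U a = tgt a := by
  change src 1 * tgt a = _
  rw [map_one, one_mul]

/-! Comultiplication -/

/-- `U° ⊗_A U°`. -/
abbrev UU : Type 1 := HH ℂ A U

theorem fst_tgt (a : A) (x y : U) :
    fst ℂ A U (tgt a * x) * snd ℂ A U y = fst ℂ A U x * snd ℂ A U (src a * y) := by
  have h := inl_eq_inr (tgtMap ℂ A U) (srcMap ℂ A U) a
  rw [tgtMap_eq, srcMap_eq] at h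
  rw [map_mul, map_mul, h]
  ring

/-- The value `∑ᵢ [φ ⊗ eᵢ] ⊗_A [eᵢ* ⊗ p]` of the comultiplication, for a basis `e`. -/
noncomputable def comulVal {P : DiffMod} {ι : Type} [Fintype ι] (b : Module.Basis ι A P)
    (φ : Dl P) (p : P) : UU :=
  ∑ i, fst ℂ A U (mk φ (b i)) * snd ℂ A U (mk (b.coord i) p)

theorem comulVal_nat {P Q : DiffMod} (t : P →ₗ[A] Q) (ht : IsHom t) {ι κ : Type} [Fintype ι]
    [Fintype κ] (b : Module.Basis ι A P) (c : Module.Basis κ A Q) (ψ : Dl Q) (p : P) :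
    comulVal c ψ (t p) = comulVal b (ψ ∘ₗ t) p := by
  unfold comulVal
  have h1 : ∀ i, mk (ψ ∘ₗ t) (b i) = ∑ j, tgt (c.coord j (t (b i))) * mk ψ (c j) := by
    intro i
    rw [← mk_rel t ht]
    conv_lhs => rw [← c.sum_repr (t (b i))]
    rw [mk_sum_right]
    exact Finset.sum_congr rfl fun j _ => (tgt_mul_mk _ _ _).symm
  have h2 : ∀ j, mk (c.coord j) (t p) = ∑ i, src (c.coord j (t (b i))) * mk (b.coord i) p := by
    intro j
    rw [mk_rel t ht]
    have h3 : (c.coord j) ∘ₗ t = ∑ i, (c.coord j (t (b i))) • b.coord i := by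
      refine b.ext fun k => ?_
      rw [LinearMap.sum_apply]
      simp only [LinearMap.smul_apply, Module.Basis.coord_apply, Module.Basis.repr_self,
        LinearMap.comp_apply, smul_eq_mul]
      classical
      simp only [Finsupp.single_apply, mul_ite, mul_one, mul_zero, Finset.sum_ite_eq,
        Finset.mem_univ, if_true]
    rw [h3, mk_sum_left]
    exact Finset.sum_congr rfl fun i _ => (src_mul_mk _ _ _).symm
  simp only [h1, h2, map_sum, Finset.sum_mul, Finset.mul_sum, fst_tgt]
  exact Finset.sum_comm

/-- The comultiplication of `U°`, as an additive map. -/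
noncomputable def comulAdd : U →+ UU :=
  liftF (fun P φ p => comulVal (Module.Free.chooseBasis A P) φ p)
    (fun _ _ _ _ => by
      unfold comulVal
      simp only [mk_add_left, map_add, add_mul, Finset.sum_add_distrib])
    (fun _ _ _ _ => by
      unfold comulVal
      simp only [mk_add_right, map_add, mul_add, Finset.sum_add_distrib])
    (fun _ _ t ht ψ p => comulVal_nat t ht _ _ ψ p)

theorem isHom_id (P : DiffMod) : IsHom (LinearMap.id : P →ₗ[A] P) := fun _ => rfl

theorem comulAdd_mk {P : DiffMod} {ι : Type} [Fintype ι] (b : Module.Basis ι A P)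
    (φ : Dl P) (p : P) : comulAdd (mk φ p) = comulVal b φ p :=
  (liftF_mk _ _ _ _ φ p).trans (comulVal_nat LinearMap.id (isHom_id P) _ _ φ p)

/-- The basis `{1}` of the unit object. -/
noncomputable def unitBasis : Module.Basis Unit A unitObj := Module.Basis.singleton Unit A

theorem comulAdd_unit (a b : A) : comulAdd (mk (lmul a) (el b)) =
    fst ℂ A U (mk (lmul a) (el 1)) * snd ℂ A U (mk (lmul 1) (el b)) := by
  have h1 : ∀ i, unitBasis i = el 1 := fun i => Module.Basis.singleton_apply Unit A i
  have h2 : ∀ i, unitBasis.coord i = lmul 1 := fun i => unit_ext (by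
    rw [lmul_el, one_mul, ← h1 i, Module.Basis.coord_apply, Module.Basis.repr_self,
      Finsupp.single_eq_same])
  rw [comulAdd_mk unitBasis]
  unfold comulVal
  simp only [h1, h2, Fintype.sum_unique]

/-- The product basis of `tens P Q`. -/
noncomputable def tensBasis {P Q : DiffMod} {ι κ : Type} (b : Module.Basis ι A P)
    (c : Module.Basis κ A Q) : Module.Basis (ι × κ) A (tens P Q) := b.tensorProduct c

theorem comulAdd_mul (x y : U) : comulAdd (x * y) = comulAdd x * comulAdd y := by
  induction x using U_induction with
  | h0 => simp only [map_zero, zero_mul]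
  | ha x x' hx hx' => simp only [map_add, add_mul, hx, hx']
  | hm P φ p =>
    induction y using U_induction with
    | h0 => simp only [map_zero, mul_zero]
    | ha x x' hx hx' => simp only [map_add, mul_add, hx, hx']
    | hm Q ψ q =>
      let b := Module.Free.chooseBasis A P
      let c := Module.Free.chooseBasis A Q
      rw [mk_mul, comulAdd_mk (tensBasis c b), comulAdd_mk b, comulAdd_mk c]
      unfold comulVal
      rw [Finset.sum_mul_sum, Fintype.sum_prod_type, Finset.sum_comm]
      refine Finset.sum_congr rfl fun i _ => Finset.sum_congr rfl fun j _ => ?_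
      have h1 : tensBasis c b (j, i) = tm (c j) (b i) :=
        Module.Basis.tensorProduct_apply c b j i
      have h2 : (tensBasis c b).coord (j, i) = star (c.coord j) (b.coord i) := by
        refine tens_ext fun x y => ?_
        rw [star_tm]
        refine (Module.Basis.tensorProduct_repr_tmul_apply c b x y j i).trans ?_
        rw [smul_eq_mul, mul_comm]; rfl
      rw [h1, h2, ← mk_mul, ← mk_mul, map_mul, map_mul]
      ring

/-- The comultiplication `[φ ⊗ p] ↦ ∑ᵢ [φ ⊗ eᵢ] ⊗_A [eᵢ* ⊗ p]` of `U°`. -/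
noncomputable def comul : U →+* UU where
  __ := comulAdd
  map_one' := by
    change comulAdd (mk (lmul 1) (el 1)) = 1
    rw [comulAdd_unit, ← one_def, map_one, map_one, mul_one]
  map_mul' := comulAdd_mul

theorem comul_mk {P : DiffMod} {ι : Type} [Fintype ι] (b : Module.Basis ι A P)
    (φ : Dl P) (p : P) : comul (mk φ p) =
      ∑ i, fst ℂ A U (mk φ (b i)) * snd ℂ A U (mk (b.coord i) p) := comulAdd_mk b φ p

/-- The counit of `U°`, as an additive map. -/
noncomputable def counitAdd : U →+ A :=
  liftF (fun _ φ p => φ p) (fun _ _ _ _ => rfl) (fun _ φ p p' => map_add φ p p')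
    (fun _ _ _ _ _ _ => rfl)

theorem counitAdd_mk {P : DiffMod} (φ : Dl P) (p : P) : counitAdd (mk φ p) = φ p :=
  liftF_mk _ _ _ _ φ p

/-- The counit `[φ ⊗ p] ↦ φ(p)` of `U°`. -/
noncomputable def counit : U →+* A where
  __ := counitAdd
  map_one' := by
    change counitAdd (mk (lmul 1) (el 1)) = 1
    rw [counitAdd_mk]
    exact one_mul _
  map_mul' x y := by
    change counitAdd (x * y) = counitAdd x * counitAdd y
    induction x using U_induction with
    | h0 => simp only [map_zero, zero_mul]
    | ha x x' hx hx' => simp only [map_add, add_mul, hx, hx']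
    | hm P φ p =>
      induction y using U_induction with
      | h0 => simp only [map_zero, mul_zero]
      | ha x x' hx hx' => simp only [map_add, mul_add, hx, hx']
      | hm Q ψ q => rw [mk_mul, counitAdd_mk, counitAdd_mk, counitAdd_mk, star_tm, mul_comm]

theorem counit_mk {P : DiffMod} (φ : Dl P) (p : P) : counit (mk φ p) = φ p :=
  counitAdd_mk φ p


theorem sum_coord {P : DiffMod} {ι : Type} [Fintype ι] (b : Module.Basis ι A P) (φ : Dl P) :
    ∑ i, φ (b i) • b.coord i = φ := by
  classical
  refine b.ext fun k => ?_
  rw [LinearMap.sum_apply]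
  simp only [LinearMap.smul_apply, Module.Basis.coord_apply, Module.Basis.repr_self,
    smul_eq_mul, Finsupp.single_apply, mul_ite, mul_one, mul_zero, Finset.sum_ite_eq,
    Finset.mem_univ, if_true]

theorem sum_basis {P : DiffMod} {ι : Type} [Fintype ι] (b : Module.Basis ι A P) (p : P) :
    ∑ i, b.coord i p • b i = p := b.sum_repr p

/-- The bialgebroid structure of `U°`. -/
noncomputable def bialg : CommBialgebroid ℂ A U where
  comul := comul
  counit := counit
  comul_src a := by
    rw [srcMap_eq]
    refine (comulAdd_unit a 1).trans ?_
    rw [← one_def, map_one, mul_one]; rfl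
  comul_tgt a := by
    rw [tgtMap_eq]
    refine (comulAdd_unit 1 a).trans ?_
    rw [← one_def, map_one, one_mul]; rfl
  counit_src a := by
    rw [srcMap_eq]
    exact (counit_mk _ _).trans (mul_one a)
  counit_tgt a := by
    rw [tgtMap_eq]
    exact (counit_mk _ _).trans (one_mul a)
  counit_left h := by
    induction h using U_induction with
    | h0 => simp only [map_zero]
    | ha x y hx hy => simp only [map_add, hx, hy]
    | hm P φ p =>
      let b := Module.Free.chooseBasis A P
      rw [comul_mk b]
      simp only [map_sum, map_mul, BTlift_inl, BTlift_inr, RingHom.comp_apply,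
        RingHom.id_apply, counit_mk, srcMap_eq, src_mul_mk]
      rw [← mk_sum_left, sum_coord]
  counit_right h := by
    induction h using U_induction with
    | h0 => simp only [map_zero]
    | ha x y hx hy => simp only [map_add, hx, hy]
    | hm P φ p =>
      let b := Module.Free.chooseBasis A P
      rw [comul_mk b]
      simp only [map_sum, map_mul, BTlift_inl, BTlift_inr, RingHom.comp_apply,
        RingHom.id_apply, counit_mk, tgtMap_eq]
      simp only [mul_comm (mk _ _) (tgt _), tgt_mul_mk]
      rw [← mk_sum_right, sum_basis]
  coassoc h := by
    induction h using U_induction with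
    | h0 => simp only [map_zero]
    | ha x y hx hy => simp only [map_add, hx, hy]
    | hm P φ p =>
      let b := Module.Free.chooseBasis A P
      rw [comul_mk b]
      simp only [map_sum, map_mul, BTlift_inl, BTlift_inr, RingHom.comp_apply]
      simp only [comul_mk b, map_sum, map_mul, tail₃, BTlift_inl, BTlift_inr,
        RingHom.comp_apply, Finset.sum_mul, Finset.mul_sum]
      rw [Finset.sum_comm]
      refine Finset.sum_congr rfl fun i _ => Finset.sum_congr rfl fun j _ => ?_
      rw [mul_assoc]

/-- A functional, as an element of the dual object. -/
def dl {P : DiffMod} (φ : Dl P) : dualObj P := φ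

/-- An element of the dual object, as a functional. -/
def fn {P : DiffMod} (x : dualObj P) : Dl P := x

/-- Evaluation at `p`, as a functional on the dual object: the image of `p` under `P → P**`. -/
noncomputable def evl {P : DiffMod} (p : P) : Dl (dualObj P) := Module.Dual.eval A P p

theorem evl_dl {P : DiffMod} (p : P) (φ : Dl P) : evl p (dl φ) = φ p := rfl

theorem dual_cases {P : DiffMod} {C : dualObj P → Prop} (h : ∀ φ : Dl P, C (dl φ))
    (x : dualObj P) : C x := h x

theorem dl_ext {P : DiffMod} {x y : dualObj P} (h : ∀ p, evl p x = evl p y) : x = y :=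
  LinearMap.ext (f := fn x) (g := fn y) h

theorem evl_d {P : DiffMod} (p : P) (x : dualObj P) :
    evl p ((dualObj P).d x) = der (evl p x) - evl (P.d p) x := rfl

/-- The transpose `Q* → P*` of a linear map `P → Q`. -/
noncomputable def transp {P Q : DiffMod} (t : P →ₗ[A] Q) : dualObj Q →ₗ[A] dualObj P :=
  Module.Dual.transpose t

theorem evl_transp {P Q : DiffMod} (t : P →ₗ[A] Q) (p : P) (x : dualObj Q) :
    evl p (transp t x) = evl (t p) x := rfl

theorem isHom_transp {P Q : DiffMod} (t : P →ₗ[A] Q) (ht : IsHom t) : IsHom (transp t) := by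
  intro x
  refine dl_ext fun p => ?_
  rw [evl_transp, evl_d, evl_d, evl_transp, evl_transp, ht p]

/-- The antipode of `U°`, as an additive map. -/
noncomputable def antipodeAdd : U →+ U :=
  liftF (fun _ φ p => mk (evl p) (dl φ))
    (fun _ _ _ _ => mk_add_right _ _ _)
    (fun P φ p p' => by
      rw [← mk_add_left]
      congr 1
      exact map_add (Module.Dual.eval A P) p p')
    (fun _ _ t ht ψ p => mk_eq (transp t) (isHom_transp t ht) rfl (fun _ => rfl))

theorem antipodeAdd_mk {P : DiffMod} (φ : Dl P) (p : P) :
    antipodeAdd (mk φ p) = mk (evl p) (dl φ) := liftF_mk _ _ _ _ φ p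

theorem dl_tens_ext {P Q : DiffMod} {x y : dualObj (tens P Q)}
    (h : ∀ p q, evl (tm p q) x = evl (tm p q) y) : x = y :=
  tens_ext (f := fn x) (g := fn y) h

/-- The linear map `A → N` sending `1` to `n`. -/
noncomputable def fromUnit {N : DiffMod} (n : N) : unitObj →ₗ[A] N :=
  LinearMap.toSpanSingleton A N n

theorem fromUnit_el {N : DiffMod} (n : N) (a : A) : fromUnit n (el a) = a • n := rfl

theorem antipodeAdd_unit (a b : A) : antipodeAdd (mk (lmul a) (el b)) = mk (lmul b) (el a) := by
  have h : ∀ c q : A, evl (el q) (c • dl (lmul 1)) = c * q := by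
    intro c q
    rw [map_smul, evl_dl, lmul_el, one_mul, smul_eq_mul]
  rw [antipodeAdd_mk]
  symm
  refine mk_eq (fromUnit (dl (lmul 1))) (fun x => ?_) ?_ fun x => ?_
  · induction x using unit_cases with | h x => ?_
    refine dl_ext fun p => ?_
    induction p using unit_cases with | h p => ?_
    rw [unit_d, evl_d, unit_d, fromUnit_el, fromUnit_el, h, h, h, der_mul]
    ring
  · refine dl_ext fun p => ?_
    induction p using unit_cases with | h p => ?_
    rw [fromUnit_el, h, evl_dl, lmul_el]
  · induction x using unit_cases with | h x => ?_
    rw [fromUnit_el, h, lmul_el, mul_comm]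

/-- The morphism `Q* ⊗ P* → (Q ⊗ P)*`, `ψ ⊗ φ ↦ ψ ⋆ φ`. -/
noncomputable def tdual (Q P : DiffMod) :
    tens (dualObj Q) (dualObj P) →ₗ[A] dualObj (tens Q P) :=
  tlift (LinearMap.mk₂ A (fun (ψ : dualObj Q) (φ : dualObj P) =>
      dl (P := tens Q P) (star (fn ψ) (fn φ)))
    (fun ψ ψ' φ => star_add_left (fn ψ) (fn ψ') (fn φ))
    (fun a ψ φ => dl_tens_ext fun x y => by
      rw [map_smul, evl_dl, evl_dl, star_tm, star_tm, smul_eq_mul, ← mul_assoc]; rfl)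
    (fun ψ φ φ' => star_add_right (fn ψ) (fn φ) (fn φ'))
    (fun a ψ φ => dl_tens_ext fun x y => by
      rw [map_smul, evl_dl, evl_dl, star_tm, star_tm, smul_eq_mul, mul_left_comm]; rfl))

theorem tdual_tm {Q P : DiffMod} (ψ : Dl Q) (φ : Dl P) :
    tdual Q P (tm (dl ψ) (dl φ)) = dl (star ψ φ) := rfl

theorem evl_tdual {Q P : DiffMod} (x : dualObj Q) (y : dualObj P) (q : Q) (p : P) :
    evl (tm q p) (tdual Q P (tm x y)) = evl q x * evl p y :=
  star_tm (fn x) (fn y) q p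

theorem evl_add {P : DiffMod} (p p' : P) (x : dualObj P) : evl (p + p') x = evl p x + evl p' x :=
  map_add (fn x) p p'

theorem isHom_tdual (Q P : DiffMod) : IsHom (tdual Q P) := by
  refine isHom_tens _ fun x y => dl_tens_ext fun q p => ?_
  rw [map_add, evl_tdual, evl_tdual, evl_d, evl_d, evl_d, tens_d, evl_add, evl_tdual, evl_tdual,
    evl_tdual, der_mul]
  ring

theorem antipodeAdd_mul (x y : U) : antipodeAdd (x * y) = antipodeAdd x * antipodeAdd y := by
  induction x using U_induction with
  | h0 => simp only [map_zero, zero_mul]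
  | ha x x' hx hx' => simp only [map_add, add_mul, hx, hx']
  | hm P φ p =>
    induction y using U_induction with
    | h0 => simp only [map_zero, mul_zero]
    | ha x x' hx hx' => simp only [map_add, mul_add, hx, hx']
    | hm Q ψ q =>
      rw [mk_mul, antipodeAdd_mk, antipodeAdd_mk, antipodeAdd_mk, mk_mul]
      symm
      refine mk_eq (tdual Q P) (isHom_tdual Q P) (tdual_tm ψ φ) fun z => ?_
      refine LinearMap.congr_fun (f := (evl (tm q p)) ∘ₗ tdual Q P)
        (tens_ext fun x y => ?_) z
      rw [star_tm, LinearMap.comp_apply, evl_tdual]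

/-- The antipode `[φ ⊗ p] ↦ [ψ(p) ⊗ φ]` of `U°`, with `ψ : P → P**` the canonical map. -/
noncomputable def antipode : U →+* U where
  __ := antipodeAdd
  map_one' := antipodeAdd_unit 1 1
  map_mul' := antipodeAdd_mul

theorem antipode_mk {P : DiffMod} (φ : Dl P) (p : P) :
    antipode (mk φ p) = mk (evl p) (dl φ) := antipodeAdd_mk φ p

theorem antipode_antipode (h : U) : antipode (antipode h) = h := by
  induction h using U_induction with
  | h0 => simp only [map_zero]
  | ha x y hx hy => simp only [map_add, hx, hy]
  | hm P φ p =>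
    rw [antipode_mk, antipode_mk]
    symm
    refine mk_eq (Module.Dual.eval A P : P →ₗ[A] dualObj (dualObj P)) (fun x => ?_) rfl
      fun _ => rfl
    refine dl_ext fun f => ?_
    induction f using dual_cases with | h f => ?_
    change f (P.d x) = der (f x) - (der (f x) - f (P.d x))
    ring

/-- The coevaluation `A → P* ⊗ P`, `1 ↦ ∑ eᵢ* ⊗ eᵢ`. -/
noncomputable def coev {P : DiffMod} {ι : Type} [Fintype ι] (b : Module.Basis ι A P) :
    unitObj →ₗ[A] tens (dualObj P) P :=
  fromUnit (∑ i, tm (dl (b.coord i)) (b i))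

theorem coev_el {P : DiffMod} {ι : Type} [Fintype ι] (b : Module.Basis ι A P) (a : A) :
    coev b (el a) = a • ∑ i, tm (dl (b.coord i)) (b i) := rfl

theorem isHom_coev {P : DiffMod} {ι : Type} [Fintype ι] (b : Module.Basis ι A P) :
    IsHom (coev b) := by
  intro x
  induction x using unit_cases with | h a => ?_
  have hz : (tens (dualObj P) P).d (∑ i, tm (dl (b.coord i)) (b i)) = 0 := by
    have h1 : ∀ i, P.d (b i) = ∑ j, b.coord j (P.d (b i)) • b j := fun i =>
      (sum_basis b _).symm
    have h2 : ∀ j, (dualObj P).d (dl (b.coord j)) =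
        ∑ i, (-(b.coord j (P.d (b i)))) • dl (b.coord i) := by
      intro j
      have h3 := sum_coord b (fn ((dualObj P).d (dl (b.coord j))))
      refine h3.symm.trans ?_
      refine Finset.sum_congr rfl fun i _ => ?_
      congr 1
      change der (b.coord j (b i)) - b.coord j (P.d (b i)) = _
      have h4 : der (b.coord j (b i)) = 0 := by
        classical
        rw [Module.Basis.coord_apply, Module.Basis.repr_self, Finsupp.single_apply]
        split_ifs
        · exact der_one
        · simp [der]
      rw [h4, zero_sub]
    have h5 : ∀ i, tm (dl (b.coord i)) (P.d (b i)) =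
        ∑ j, b.coord j (P.d (b i)) • tm (dl (b.coord i)) (b j) := by
      intro i
      conv_lhs => rw [h1 i]
      rw [← tmL_apply, map_sum]
      simp only [map_smul, tmL_apply]
    have h6 : ∀ j, tm ((dualObj P).d (dl (b.coord j))) (b j) =
        ∑ i, (-(b.coord j (P.d (b i)))) • tm (dl (b.coord i)) (b j) := by
      intro j
      rw [h2 j, ← tmL_apply, map_sum, LinearMap.sum_apply]
      simp only [map_smul, LinearMap.smul_apply, tmL_apply]
    rw [map_sum]
    simp only [tens_d, h5, h6, Finset.sum_add_distrib]
    rw [Finset.sum_comm, ← Finset.sum_add_distrib]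
    refine Finset.sum_eq_zero fun i _ => ?_
    rw [← Finset.sum_add_distrib]
    refine Finset.sum_eq_zero fun j _ => ?_
    rw [neg_smul, neg_add_cancel]
  rw [unit_d, coev_el, coev_el, (tens (dualObj P) P).leibniz, hz, smul_zero, zero_add]

/-- The evaluation `P ⊗ P* → A`. -/
noncomputable def evalMap (P : DiffMod) : tens P (dualObj P) →ₗ[A] unitObj :=
  tlift (Module.Dual.eval A P : P →ₗ[A] Dl P →ₗ[A] A)

theorem isHom_evalMap (P : DiffMod) : IsHom (evalMap P) := by
  refine isHom_tens _ fun x y => ?_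
  induction y using dual_cases with | h f => ?_
  change f (P.d x) + (der (f x) - f (P.d x)) = der (f x)
  ring

/-- The commutative Hopf algebroid structure of `U°`. -/
noncomputable def hopf : CommHopfAlgebroid ℂ A U where
  toCommBialgebroid := bialg
  antipode := antipode
  antipode_src a := by
    rw [srcMap_eq, tgtMap_eq]; exact antipodeAdd_unit a 1
  antipode_tgt a := by
    rw [srcMap_eq, tgtMap_eq]; exact antipodeAdd_unit 1 a
  antipode_antipode := antipode_antipode
  mul_antipode h := by
    change BTlift _ _ _ _ _ (comul h) = srcMap ℂ A U (counit h)
    induction h using U_induction with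
    | h0 => simp only [map_zero]
    | ha x y hx hy => simp only [map_add, hx, hy]
    | hm P φ p =>
      let b := Module.Free.chooseBasis A P
      rw [comul_mk b, counit_mk, srcMap_eq]
      simp only [map_sum, map_mul, BTlift_inl, BTlift_inr, RingHom.id_apply, antipode_mk,
        mk_mul]
      rw [← mk_sum_right]
      symm
      refine mk_eq (coev b) (isHom_coev b) ?_ fun x => ?_
      · rw [coev_el, one_smul]
      · induction x using unit_cases with | h a => ?_
        rw [coev_el, lmul_el, map_smul, map_sum, smul_eq_mul]
        simp only [star_tm, evl_dl]
        have h := congrArg φ (sum_basis b p)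
        rw [map_sum] at h
        simp only [map_smul, smul_eq_mul] at h
        rw [h, mul_comm]
  antipode_mul h := by
    change BTlift _ _ _ _ _ (comul h) = tgtMap ℂ A U (counit h)
    induction h using U_induction with
    | h0 => simp only [map_zero]
    | ha x y hx hy => simp only [map_add, hx, hy]
    | hm P φ p =>
      let b := Module.Free.chooseBasis A P
      rw [comul_mk b, counit_mk, tgtMap_eq]
      simp only [map_sum, map_mul, BTlift_inl, BTlift_inr, RingHom.id_apply, antipode_mk,
        mk_mul]
      rw [← mk_sum_left]
      refine mk_eq (evalMap P) (isHom_evalMap P) rfl fun z => ?_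
      refine LinearMap.congr_fun (f := (lmul 1) ∘ₗ evalMap P) (tens_ext fun x y => ?_) z
      induction y using dual_cases with | h f => ?_
      change 1 * f x = _
      rw [LinearMap.sum_apply]
      simp only [star_tm, evl_dl]
      have h := congrArg f (sum_basis b x)
      rw [map_sum] at h
      simp only [map_smul, smul_eq_mul] at h
      rw [one_mul, ← h]

/-! The subalgebras attached to a differential module -/

/-- The `(A ⊗ A)`-subalgebra of `U°` generated by the image of `M* ⊗ M → U°`. -/
noncomputable def UM (M : DiffMod) : Subalgebra (A ⊗[ℂ] A) U :=
  Algebra.adjoin (A ⊗[ℂ] A) {u | ∃ (φ : Dl M) (x : M), u = mk φ x}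

/-- The tensor powers `M^{⊗ n}`. -/
noncomputable def tpow (M : DiffMod) : ℕ → DiffMod
  | 0 => unitObj
  | n + 1 => tens M (tpow M n)

/-- The element `x_n ⊗ ⋯ ⊗ x_1` of `M^{⊗ n}`. -/
noncomputable def tmulRev {M : DiffMod} : (n : ℕ) → (Fin n → M) → tpow M n
  | 0, _ => el 1
  | n + 1, x => tm (x (Fin.last n)) (tmulRev n fun i => x i.castSucc)

/-- The functional `φ_n ⋆ ⋯ ⋆ φ_1` on `M^{⊗ n}`. -/
noncomputable def starRev {M : DiffMod} : (n : ℕ) → (Fin n → Dl M) → Dl (tpow M n)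
  | 0, _ => lmul 1
  | n + 1, φ => star (φ (Fin.last n)) (starRev n fun i => φ i.castSucc)

/-- `det(e_1, …, e_m) = ∑_σ sgn(σ) e_{σ(m)} ⊗ ⋯ ⊗ e_{σ(1)}`. -/
noncomputable def detVec {M : DiffMod} {m : ℕ} (e : Fin m → M) : tpow M m :=
  ∑ σ : Equiv.Perm (Fin m), ((Equiv.Perm.sign σ : ℤ)) • tmulRev m (fun i => e (σ i))

/-- `det_M = [(e_m* ⋆ ⋯ ⋆ e_1*) ⊗ det(e_1, …, e_m)]`. -/
noncomputable def detM {M : DiffMod} {m : ℕ} (e : Module.Basis (Fin m) A M) : U :=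
  mk (starRev m fun i => e.coord i) (detVec fun i => e i)

/-- The matrix `u_{ij} = [e_i* ⊗ e_j]`. -/
noncomputable def uMat {M : DiffMod} {m : ℕ} (e : Module.Basis (Fin m) A M) :
    Matrix (Fin m) (Fin m) U :=
  fun i j => mk (e.coord i) (e j)

/-- The subalgebra of `U°` generated by `UM M` and the inverse of `det_M`. -/
noncomputable def UMdet {M : DiffMod} {m : ℕ} (e : Module.Basis (Fin m) A M) :
    Subalgebra (A ⊗[ℂ] A) U :=
  Algebra.adjoin (A ⊗[ℂ] A) ((UM M : Set U) ∪ {Ring.inverse (detM e)})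

theorem UM_le_UMdet {M : DiffMod} {m : ℕ} (e : Module.Basis (Fin m) A M) :
    UM M ≤ UMdet e := fun _ hx => Algebra.subset_adjoin (Or.inl hx)

/-- For subalgebras `V ≤ W` and `x ∈ V`: the inclusion `V → W` is the localization of the ring
`V` at the powers of `x`. -/
def IsLocalizationAt {R H : Type*} [CommRing R] [CommRing H] [Algebra R H]
    (V W : Subalgebra R H) (hVW : V ≤ W) (x : V) : Prop :=
  letI : Algebra V W := (Subalgebra.inclusion hVW).toRingHom.toAlgebra
  IsLocalization.Away x W

end FinDual

/-!
The difficulty in showing that a subalgebra `V` of `U°` is a bialgebroid is that its comultiplication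
has to take values in `V ⊗_A V`, which need not embed into `U° ⊗_A U°` a priori.  It does embed here,
because `U°` is torsion-free, hence flat, over the principal ideal domain `A = ℂ[X]` on both sides.
Indeed every element of `U°` is a single class `[φ ⊗ p]`, by direct sums, and this class is zero as
soon as `φ(∂ᵏ p) = 0` for all `k`, because it can be computed on the differential submodule
generated by `p`.  So `U°` embeds into the functions `ℕ → A` compatibly with the source map
(`eq_zero_of_src_mul_eq_zero`); the antipode transports this to the target map.  Flatness makes
`V ⊗_A V` and `V ⊗_A V ⊗_A V` embed into the tensor powers of `U°`, and so a subalgebra with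
`Δ(V)` in the image of `V ⊗_A V` inherits all the axioms (`isSubBialgebroid_of_comul_mem`); if it is
stable under the antipode as well, it is a Hopf subalgebroid (`isHopfSubalgebroid_of_comul_mem`).

The rest is the theory of matrix coefficients.  The matrix `u = (u_{ij})` satisfies
`Δ(u_{ij}) = ∑ₖ u_{ik} ⊗ u_{kj}` and `ε(u) = 1`, so the antipode axiom reads `u * S(u) = 1`
(`uMat_mul_antipode`).  As `det_M` is the determinant of `u` (`detM_eq_det`), it is a unit with
inverse `S(det_M)`, and Cramer's rule gives `S(u) = det_M⁻¹ adj(u)`.  Finally `det_M` is grouplike by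
multiplicativity of the determinant, hence so is its inverse, and both subalgebras are closed under
`Δ`, the second one also under `S`.
-/

namespace FinDual

/-! ### Subalgebras of torsion-free bialgebroids -/

section SubBialgebroid

universe u v w x

section BT

variable {A : Type u} {B : Type v} {C : Type w} {D : Type x} [CommRing A] [CommRing B]
  [CommRing C] [CommRing D]

theorem BT_hom_ext {β : A →+* B} {γ : A →+* C} {f g : BT β γ →+* D}
    (hl : ∀ b, f (inl β γ b) = g (inl β γ b)) (hr : ∀ c, f (inr β γ c) = g (inr β γ c)) :
    f = g := by
  refine RingHom.ext fun z => ?_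
  induction z using TensorProduct.induction_on with
  | zero => rw [map_zero, map_zero]
  | add y z hy hz => rw [map_add, map_add, hy, hz]
  | tmul b c =>
    have h : b ⊗ₜ[A] c = inl β γ b * inr β γ c := by
      change _ = (b ⊗ₜ[A] (1 : Via γ)) * ((1 : Via β) ⊗ₜ[A] c)
      rw [Algebra.TensorProduct.tmul_mul_tmul, mul_one, one_mul]
    rw [h, map_mul, map_mul]
    exact congrArg₂ (· * ·) (hl b) (hr c)

theorem isTorsionFree_via_of_injective [IsDomain A] {β : A →+* B} {γ : A →+* C} (f : B →+* C)
    (hf : Function.Injective f) (hβ : ∀ a, f (β a) = γ a) [Module.IsTorsionFree A (Via γ)] :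
    Module.IsTorsionFree A (Via β) :=
  Function.Injective.moduleIsTorsionFree (N := Via γ) (f : B → C) hf fun a b =>
    (map_mul f (β a) b).trans (congrArg (· * f b) (hβ a))

theorem isTorsionFree_via [IsDomain A] {β : A →+* B}
    (h : ∀ a ≠ 0, ∀ b, β a * b = 0 → b = 0) : Module.IsTorsionFree A (Via β) where
  isSMulRegular a ha x y hxy := by
    let x' : B := x
    let y' : B := y
    have hxy' : β a * x' = β a * y' := hxy
    exact sub_eq_zero.mp (h a ha.ne_zero (x' - y') (by rw [mul_sub, hxy', sub_self]))

/-- A map of tensor products of rings, induced by injective maps `f` and `g` of the factors, is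
injective if the target of `f` and the source of `g` are flat. -/
theorem BTlift_injective {B' C' : Type*} [CommRing B'] [CommRing C'] (β : A →+* B)
    (γ : A →+* C) (β' : A →+* B') (γ' : A →+* C') (f : B →+* B') (g : C →+* C')
    (hβ : ∀ a, f (β a) = β' a) (hγ : ∀ a, g (γ a) = γ' a)
    [Module.Flat A (Via β')] [Module.Flat A (Via γ)]
    (hf : Function.Injective f) (hg : Function.Injective g)
    (h : ∀ a, (inl β' γ').comp f (β a) = (inr β' γ').comp g (γ a)) :
    Function.Injective (BTlift β γ ((inl β' γ').comp f) ((inr β' γ').comp g) h) := by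
  let F : Via β →ₐ[A] Via β' := { (f : Via β →+* Via β') with commutes' := hβ }
  let G : Via γ →ₐ[A] Via γ' := { (g : Via γ →+* Via γ') with commutes' := hγ }
  have key : BTlift β γ ((inl β' γ').comp f) ((inr β' γ').comp g) h =
      ((Algebra.TensorProduct.map F G : BT β γ →ₐ[A] BT β' γ') : BT β γ →+* BT β' γ') := by
    refine BT_hom_ext (fun b => ?_) fun c => ?_
    · rw [BTlift_inl]
      exact congrArg (fun y => F b ⊗ₜ[A] y) (map_one G).symm
    · rw [BTlift_inr]
      exact congrArg (fun y => y ⊗ₜ[A] G c) (map_one F).symm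
  rw [key]
  exact TensorProduct.map_injective_of_flat_flat F.toLinearMap G.toLinearMap hf hg

/-- If `B` is flat over `A` and `C` is torsion-free for a second action `δ` of `A`, then `B ⊗_A C`
is torsion-free for `δ`. -/
theorem isTorsionFree_inr [IsDomain A] (β : A →+* B) (γ δ : A →+* C) [Module.Flat A (Via β)]
    [Module.IsTorsionFree A (Via δ)] : Module.IsTorsionFree A (Via ((inr β γ).comp δ)) where
  isSMulRegular a ha := by
    let d : Via γ := δ a
    let μ : Via γ →ₗ[A] Via γ := LinearMap.mulLeft A d
    have hμ : Function.Injective μ := fun x y hxy =>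
      Module.IsTorsionFree.isSMulRegular (M := Via δ) ha hxy
    have hinj := Module.Flat.lTensor_preserves_injective_linearMap (M := Via β) μ hμ
    have key : ∀ z : BT β γ, inr β γ (δ a) * z = LinearMap.lTensor (Via β) μ z := by
      intro z
      induction z using TensorProduct.induction_on with
      | zero => rw [mul_zero, map_zero]
      | add y z hy hz => rw [mul_add, map_add, hy, hz]
      | tmul b c =>
        rw [LinearMap.lTensor_tmul]
        refine (Algebra.TensorProduct.tmul_mul_tmul (1 : Via β) b d c).trans ?_
        rw [one_mul]; rfl
    intro x y hxy
    refine hinj ((key x).symm.trans (Eq.trans ?_ (key y)))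
    exact hxy

end BT

variable {K : Type u} {A : Type v} {H : Type w} [CommRing K] [CommRing A] [Algebra K A]
  [CommRing H] [Algebra (A ⊗[K] A) H]

theorem algebraMap_tmul (a b : A) :
    algebraMap (A ⊗[K] A) H (a ⊗ₜ b) = srcMap K A H a * tgtMap K A H b := by
  change _ = algebraMap (A ⊗[K] A) H (a ⊗ₜ 1) * algebraMap (A ⊗[K] A) H (1 ⊗ₜ b)
  rw [← map_mul, Algebra.TensorProduct.tmul_mul_tmul, mul_one, one_mul]

theorem inclTensor_fst (V : Subalgebra (A ⊗[K] A) H) (v : V) :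
    inclTensor V (fst K A V v) = fst K A H v := BTlift_inl ..

theorem inclTensor_snd (V : Subalgebra (A ⊗[K] A) H) (v : V) :
    inclTensor V (snd K A V v) = snd K A H v := BTlift_inr ..

theorem coe_srcMap (V : Subalgebra (A ⊗[K] A) H) (a : A) :
    (srcMap K A V a : H) = srcMap K A H a := rfl

theorem coe_tgtMap (V : Subalgebra (A ⊗[K] A) H) (a : A) :
    (tgtMap K A V a : H) = tgtMap K A H a := rfl

/-- The map `V ⊗_A V ⊗_A V → H ⊗_A H ⊗_A H` induced by the inclusion of a subalgebra. -/
noncomputable def inclTensor₃ (V : Subalgebra (A ⊗[K] A) H) : HHH K A V →+* HHH K A H :=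
  BTlift ((snd K A V).comp (tgtMap K A V)) (srcMap K A V) ((fst₃ K A H).comp (inclTensor V))
    ((snd₃ K A H).comp V.val.toRingHom) (fun a =>
      (congrArg (fst₃ K A H) (inclTensor_snd V (tgtMap K A V a))).trans
        (inl_eq_inr ((snd K A H).comp (tgtMap K A H)) (srcMap K A H) a))

theorem inclTensor₃_fst₃ (V : Subalgebra (A ⊗[K] A) H) (z : HH K A V) :
    inclTensor₃ V (fst₃ K A V z) = fst₃ K A H (inclTensor V z) := BTlift_inl ..

theorem inclTensor₃_snd₃ (V : Subalgebra (A ⊗[K] A) H) (v : V) :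
    inclTensor₃ V (snd₃ K A V v) = snd₃ K A H v := BTlift_inr ..

theorem inclTensor₃_tail₃ (V : Subalgebra (A ⊗[K] A) H) (z : HH K A V) :
    inclTensor₃ V (tail₃ K A V z) = tail₃ K A H (inclTensor V z) := by
  refine congrArg (fun f => f z) (BT_hom_ext
    (f := (inclTensor₃ V).comp (tail₃ K A V)) (g := (tail₃ K A H).comp (inclTensor V))
    (fun v => ?_) fun v => ?_)
  · simp only [RingHom.comp_apply, inclTensor_fst, tail₃, BTlift_inl, inclTensor₃_fst₃,
      inclTensor_snd]
  · simp only [RingHom.comp_apply, inclTensor_snd, tail₃, BTlift_inr, inclTensor₃_snd₃]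

/-- Compatibility of the induced maps out of `V ⊗_A V` and `H ⊗_A H`. -/
theorem BTlift_inclTensor {D D' : Type*} [CommRing D] [CommRing D']
    (V : Subalgebra (A ⊗[K] A) H) (i : D →+* D') (f : V →+* D) (g : V →+* D) (f' g' : H →+* D')
    (h : ∀ a, f (tgtMap K A V a) = g (srcMap K A V a))
    (h' : ∀ a, f' (tgtMap K A H a) = g' (srcMap K A H a))
    (hf : ∀ v, i (f v) = f' v) (hg : ∀ v, i (g v) = g' v) (z : HH K A V) :
    i (BTlift (tgtMap K A V) (srcMap K A V) f g h z) =
      BTlift (tgtMap K A H) (srcMap K A H) f' g' h' (inclTensor V z) := by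
  refine congrArg (fun f => f z) (BT_hom_ext
    (f := i.comp (BTlift (tgtMap K A V) (srcMap K A V) f g h))
    (g := (BTlift (tgtMap K A H) (srcMap K A H) f' g' h').comp (inclTensor V))
    (fun v => ?_) fun v => ?_)
  · simp only [RingHom.comp_apply, BTlift_inl, inclTensor_fst, hf]
  · simp only [RingHom.comp_apply, BTlift_inr, inclTensor_snd, hg]

theorem flat_via_srcMap [IsDomain A] [IsPrincipalIdealRing A]
    [Module.IsTorsionFree A (Via (srcMap K A H))] (V : Subalgebra (A ⊗[K] A) H) :
    Module.Flat A (Via (srcMap K A V)) := by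
  have : Module.IsTorsionFree A (Via (srcMap K A V)) :=
    isTorsionFree_via_of_injective V.val.toRingHom Subtype.val_injective (coe_srcMap V)
  infer_instance

section TorsionFree

variable [IsDomain A] [IsPrincipalIdealRing A] [Module.IsTorsionFree A (Via (srcMap K A H))]
  [Module.IsTorsionFree A (Via (tgtMap K A H))]

theorem inclTensor_injective (V : Subalgebra (A ⊗[K] A) H) :
    Function.Injective (inclTensor V) := by
  have := flat_via_srcMap V
  exact BTlift_injective (tgtMap K A V) (srcMap K A V) (tgtMap K A H) (srcMap K A H)
    V.val.toRingHom V.val.toRingHom (coe_tgtMap V) (coe_srcMap V) Subtype.val_injective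
    Subtype.val_injective _

theorem inclTensor₃_injective (V : Subalgebra (A ⊗[K] A) H) :
    Function.Injective (inclTensor₃ V) := by
  have := flat_via_srcMap V
  have : Module.IsTorsionFree A (Via ((snd K A H).comp (tgtMap K A H))) :=
    isTorsionFree_inr (tgtMap K A H) (srcMap K A H) (tgtMap K A H)
  exact BTlift_injective ((snd K A V).comp (tgtMap K A V)) (srcMap K A V)
    ((snd K A H).comp (tgtMap K A H)) (srcMap K A H)
    (inclTensor V) V.val.toRingHom (fun a => inclTensor_snd V (tgtMap K A V a)) (coe_srcMap V)
    (inclTensor_injective V) Subtype.val_injective _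

/-- The comultiplication of a subalgebra `V` with `Δ(V)` contained in the image of `V ⊗_A V`. -/
noncomputable def subComul (h : CommBialgebroid K A H) (V : Subalgebra (A ⊗[K] A) H)
    (hV : ∀ v ∈ V, h.comul v ∈ (inclTensor V).range) : V →+* HH K A V :=
  (RingEquiv.ofLeftInverse
      (Function.leftInverse_invFun (inclTensor_injective V))).symm.toRingHom.comp
    ((h.comul.comp V.val.toRingHom).codRestrict (inclTensor V).range fun v => hV v v.2)

theorem inclTensor_subComul (h : CommBialgebroid K A H) (V : Subalgebra (A ⊗[K] A) H)
    (hV : ∀ v ∈ V, h.comul v ∈ (inclTensor V).range) (v : V) :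
    inclTensor V (subComul h V hV v) = h.comul v :=
  congrArg Subtype.val ((RingEquiv.ofLeftInverse
    (Function.leftInverse_invFun (inclTensor_injective V))).apply_symm_apply
      ⟨h.comul v, hV v v.2⟩)

/-- A subalgebra `V` of a bialgebroid which is torsion-free on both sides over a principal ideal
domain is a bialgebroid as soon as `Δ(V)` lies in the image of `V ⊗_A V`: all identities can be
checked after the inclusions of `V ⊗_A V` and `V ⊗_A V ⊗_A V`. -/
noncomputable def subBialgebroid (h : CommBialgebroid K A H) (V : Subalgebra (A ⊗[K] A) H)
    (hV : ∀ v ∈ V, h.comul v ∈ (inclTensor V).range) : CommBialgebroid K A V where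
  comul := subComul h V hV
  counit := h.counit.comp V.val.toRingHom
  comul_src a := inclTensor_injective V (by
    rw [inclTensor_subComul, inclTensor_fst, coe_srcMap, h.comul_src])
  comul_tgt a := inclTensor_injective V (by
    rw [inclTensor_subComul, inclTensor_snd, coe_tgtMap, h.comul_tgt])
  counit_src := h.counit_src
  counit_tgt := h.counit_tgt
  counit_left v := Subtype.val_injective (by
    refine Eq.trans ?_ (h.counit_left v)
    rw [← inclTensor_subComul h V hV]
    exact BTlift_inclTensor V V.val.toRingHom _ _ _ _ _ _ (fun _ => rfl) (fun _ => rfl) _)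
  counit_right v := Subtype.val_injective (by
    refine Eq.trans ?_ (h.counit_right v)
    rw [← inclTensor_subComul h V hV]
    exact BTlift_inclTensor V V.val.toRingHom _ _ _ _ _ _ (fun _ => rfl) (fun _ => rfl) _)
  coassoc v := inclTensor₃_injective V (by
    refine Eq.trans ?_ ((h.coassoc v).trans ?_)
    · rw [← inclTensor_subComul h V hV]
      refine BTlift_inclTensor V (inclTensor₃ V) _ _ _ _ _ _ (fun w => ?_) (fun w => ?_) _
      · rw [RingHom.comp_apply, inclTensor₃_fst₃, inclTensor_subComul]; rfl
      · exact inclTensor₃_snd₃ V w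
    · rw [← inclTensor_subComul h V hV]
      refine (BTlift_inclTensor V (inclTensor₃ V) _ _ _ _ _ _ (fun w => ?_) (fun w => ?_) _).symm
      · rw [RingHom.comp_apply, inclTensor₃_fst₃, inclTensor_fst]; rfl
      · rw [RingHom.comp_apply, inclTensor₃_tail₃, inclTensor_subComul]; rfl)

theorem isSubBialgebroid_of_comul_mem (h : CommBialgebroid K A H) (V : Subalgebra (A ⊗[K] A) H)
    (hV : ∀ v ∈ V, h.comul v ∈ (inclTensor V).range) : IsSubBialgebroid h V :=
  ⟨subBialgebroid h V hV, inclTensor_subComul h V hV, fun _ => rfl⟩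

theorem isHopfSubalgebroid_of_comul_mem (h : CommHopfAlgebroid K A H)
    (V : Subalgebra (A ⊗[K] A) H) (hV : ∀ v ∈ V, h.comul v ∈ (inclTensor V).range)
    (hS : ∀ v ∈ V, h.antipode v ∈ V) : IsHopfSubalgebroid h V :=
  ⟨{ subBialgebroid h.toCommBialgebroid V hV with
      antipode := (h.antipode.comp V.val.toRingHom).codRestrict V fun v => hS v v.2
      antipode_src := fun a => Subtype.val_injective (h.antipode_src a)
      antipode_tgt := fun a => Subtype.val_injective (h.antipode_tgt a)
      antipode_antipode := fun v => Subtype.val_injective (h.antipode_antipode v)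
      mul_antipode := fun v => Subtype.val_injective (by
        refine Eq.trans ?_ (h.mul_antipode v)
        rw [← inclTensor_subComul h.toCommBialgebroid V hV]
        exact BTlift_inclTensor V V.val.toRingHom _ _ _ _ _ _ (fun _ => rfl) (fun _ => rfl) _)
      antipode_mul := fun v => Subtype.val_injective (by
        refine Eq.trans ?_ (h.antipode_mul v)
        rw [← inclTensor_subComul h.toCommBialgebroid V hV]
        exact BTlift_inclTensor V V.val.toRingHom _ _ _ _ _ _ (fun _ => rfl) (fun _ => rfl) _) },
    inclTensor_subComul h.toCommBialgebroid V hV, fun _ => rfl, fun _ => rfl⟩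

end TorsionFree

theorem comul_mem_range_of_mem_adjoin (h : CommBialgebroid K A H) (W : Subalgebra (A ⊗[K] A) H)
    {s : Set H} (hs : ∀ x ∈ s, h.comul x ∈ (inclTensor W).range) {v : H}
    (hv : v ∈ Algebra.adjoin (A ⊗[K] A) s) : h.comul v ∈ (inclTensor W).range := by
  induction hv using Algebra.adjoin_induction with
  | mem x hx => exact hs x hx
  | add x y _ _ hx hy => rw [map_add]; exact add_mem hx hy
  | mul x y _ _ hx hy => rw [map_mul]; exact mul_mem hx hy
  | algebraMap r =>
    induction r using TensorProduct.induction_on with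
    | zero => rw [map_zero, map_zero]; exact zero_mem _
    | add x y hx hy => rw [map_add, map_add]; exact add_mem hx hy
    | tmul a b =>
      rw [algebraMap_tmul, map_mul, h.comul_src, h.comul_tgt]
      exact mul_mem ⟨_, inclTensor_fst W (srcMap K A W a)⟩ ⟨_, inclTensor_snd W (tgtMap K A W b)⟩

theorem antipode_mem_of_mem_adjoin (h : CommHopfAlgebroid K A H) (W : Subalgebra (A ⊗[K] A) H)
    {s : Set H} (hs : ∀ x ∈ s, h.antipode x ∈ W) {v : H}
    (hv : v ∈ Algebra.adjoin (A ⊗[K] A) s) : h.antipode v ∈ W := by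
  induction hv using Algebra.adjoin_induction with
  | mem x hx => exact hs x hx
  | add x y _ _ hx hy => rw [map_add]; exact add_mem hx hy
  | mul x y _ _ hx hy => rw [map_mul]; exact mul_mem hx hy
  | algebraMap r =>
    induction r using TensorProduct.induction_on with
    | zero => rw [map_zero, map_zero]; exact zero_mem _
    | add x y hx hy => rw [map_add, map_add]; exact add_mem hx hy
    | tmul a b =>
      rw [algebraMap_tmul, map_mul, h.antipode_src, h.antipode_tgt]
      exact mul_mem (tgtMap K A W a).2 (srcMap K A W b).2

end SubBialgebroid

/-! ### Determinants and adjoined inverses in subalgebras -/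

theorem det_mem_subalgebra {R H n : Type*} [CommRing R] [CommRing H] [Algebra R H] [Fintype n]
    [DecidableEq n] (V : Subalgebra R H) {N : Matrix n n H} (hN : ∀ i j, N i j ∈ V) :
    N.det ∈ V := by
  let N' : Matrix n n V := fun i j => ⟨N i j, hN i j⟩
  have h : N.det = V.val N'.det := (AlgHom.map_det V.val N').symm
  rw [h]
  exact N'.det.2

theorem adjugate_mem_subalgebra {R H n : Type*} [CommRing R] [CommRing H] [Algebra R H]
    [Fintype n] [DecidableEq n] (V : Subalgebra R H) {N : Matrix n n H}
    (hN : ∀ i j, N i j ∈ V) (i j : n) : N.adjugate i j ∈ V := by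
  let N' : Matrix n n V := fun i j => ⟨N i j, hN i j⟩
  have h : N.adjugate = V.val.mapMatrix N'.adjugate := (AlgHom.map_adjugate V.val N').symm
  rw [h]
  exact (N'.adjugate i j).2

/-- Adjoining to a subalgebra `V` an inverse of `x ∈ V` that exists in the ambient ring gives the
localization of `V` at `x`; no cancellation is needed, since `V` embeds in the ambient ring. -/
theorem isLocalizationAt_adjoin_inverse {R H : Type*} [CommRing R] [CommRing H] [Algebra R H]
    (V : Subalgebra R H) (x : V) (y : H) (hxy : (x : H) * y = 1)
    (hVW : V ≤ Algebra.adjoin R ((V : Set H) ∪ {y})) :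
    IsLocalizationAt V (Algebra.adjoin R ((V : Set H) ∪ {y})) hVW x := by
  let W := Algebra.adjoin R ((V : Set H) ∪ {y})
  have hy : y ∈ W := Algebra.subset_adjoin (Or.inr rfl)
  have hsurj : ∀ s ∈ W, ∃ (n : ℕ) (a : V), s * (x : H) ^ n = a := by
    intro s hs
    induction hs using Algebra.adjoin_induction with
    | mem s hs =>
      rcases hs with hs | rfl
      · exact ⟨0, ⟨s, hs⟩, by rw [pow_zero, mul_one]⟩
      · exact ⟨1, 1, by rw [pow_one, mul_comm, hxy]; rfl⟩
    | algebraMap r => exact ⟨0, algebraMap R V r, by rw [pow_zero, mul_one]; rfl⟩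
    | add s t _ _ hs ht =>
      obtain ⟨n, a, ha⟩ := hs
      obtain ⟨k, b, hb⟩ := ht
      refine ⟨n + k, a * x ^ k + b * x ^ n, ?_⟩
      push_cast
      rw [← ha, ← hb]
      ring
    | mul s t _ _ hs ht =>
      obtain ⟨n, a, ha⟩ := hs
      obtain ⟨k, b, hb⟩ := ht
      refine ⟨n + k, a * b, ?_⟩
      push_cast
      rw [← ha, ← hb]
      ring
  let : Algebra V W := (Subalgebra.inclusion hVW).toRingHom.toAlgebra
  refine IsLocalization.Away.mk x ?_ (fun s => ?_) fun a b hab => ⟨0, ?_⟩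
  · exact IsUnit.of_mul_eq_one (⟨y, hy⟩ : W) (Subtype.val_injective hxy)
  · obtain ⟨n, a, h⟩ := hsurj s s.2
    exact ⟨n, a, Subtype.val_injective h⟩
  · have : a = b := Subtype.val_injective (congrArg (fun w : W => (w : H)) hab)
    rw [this]

/-! ### Torsion-freeness of the finite dual -/

/-- The direct sum of two differential modules. -/
noncomputable def dsum (P Q : DiffMod) : DiffMod where
  carrier := P × Q
  d := P.d.prodMap Q.d
  leibniz a x := Prod.ext (P.leibniz a x.1) (Q.leibniz a x.2)

/-- By means of direct sums, every element of `U°` is a single class `[φ ⊗ p]`. -/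
theorem exists_eq_mk (z : U) : ∃ (P : DiffMod) (φ : Dl P) (p : P), z = mk φ p := by
  induction z using U_induction with
  | h0 => exact ⟨unitObj, lmul 1, 0, (map_zero (mkHom unitObj (lmul 1))).symm⟩
  | hm P φ p => exact ⟨P, φ, p, rfl⟩
  | ha x y hx hy =>
    obtain ⟨P, φ, p, rfl⟩ := hx
    obtain ⟨Q, ψ, q, rfl⟩ := hy
    let θ : Dl (dsum P Q) := LinearMap.coprod φ ψ
    let i : P →ₗ[A] dsum P Q := LinearMap.inl A P Q
    let j : Q →ₗ[A] dsum P Q := LinearMap.inr A P Q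
    have hi : IsHom i := fun x => Prod.ext rfl (map_zero Q.d).symm
    have hj : IsHom j := fun x => Prod.ext (map_zero P.d).symm rfl
    refine ⟨dsum P Q, θ, i p + j q, ?_⟩
    rw [mk_add_right, mk_rel i hi, mk_rel j hj]
    congr 2
    · exact (LinearMap.coprod_inl φ ψ).symm
    · exact (LinearMap.coprod_inr φ ψ).symm

/-- The differential submodule generated by `p`, spanned over `A` by the iterates `∂ᵏ p`.  It is
finitely generated over `A` because `A` is Noetherian. -/
noncomputable def generatedBy {P : DiffMod} (p : P) : DiffMod where
  carrier := Submodule.span A (Set.range fun k => P.d^[k] p)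
  d := AddMonoidHom.mk' (fun x => ⟨P.d x, by
      obtain ⟨x, hx⟩ := x
      induction hx using Submodule.span_induction with
      | mem x hx =>
        obtain ⟨k, rfl⟩ := hx
        exact Submodule.subset_span ⟨k + 1, Function.iterate_succ_apply' P.d k p⟩
      | zero => rw [map_zero]; exact zero_mem _
      | add x y _ _ hx hy => rw [map_add]; exact add_mem hx hy
      | smul a x hx hdx =>
        rw [P.leibniz]
        exact add_mem (Submodule.smul_mem _ _ hdx) (Submodule.smul_mem _ _ hx)⟩)
    fun x y => Subtype.ext (map_add P.d x.1 y.1)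
  leibniz a x := Subtype.ext (P.leibniz a x.1)

/-- If `φ` vanishes on all `∂ᵏ p`, the class `[φ ⊗ p]` can be formed on the differential submodule
generated by `p`, where `φ` restricts to zero.  Together with `pairing` this shows that `U°` embeds
into the functions `ℕ → A`. -/
theorem mk_eq_zero_of_forall_iterate {P : DiffMod} {φ : Dl P} {p : P}
    (h : ∀ k, φ (P.d^[k] p) = 0) : mk φ p = 0 := by
  let t : generatedBy p →ₗ[A] P :=
    (Submodule.span A (Set.range fun k => P.d^[k] p)).subtype
  let p' : generatedBy p :=
    (⟨p, Submodule.subset_span ⟨0, rfl⟩⟩ : Submodule.span A (Set.range fun k => P.d^[k] p))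
  have h0 : φ ∘ₗ t = 0 := by
    refine LinearMap.ext fun x => ?_
    obtain ⟨x, hx⟩ := x
    change φ x = 0
    induction hx using Submodule.span_induction with
    | mem x hx =>
      obtain ⟨k, rfl⟩ := hx
      exact h k
    | zero => exact map_zero φ
    | add x y _ _ hx hy => rw [map_add, hx, hy, add_zero]
    | smul a x _ hx => rw [map_smul, hx, smul_zero]
  change mk φ (t p') = 0
  rw [mk_rel t (fun _ => rfl), h0, ← mkHom_apply, map_zero, AddMonoidHom.zero_apply]

/-- The pairing of `U°` with the powers of the derivation, `[φ ⊗ p] ↦ (φ(∂ᵏ p))ₖ`. -/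
noncomputable def pairing : U →+ ℕ → A :=
  liftF (fun P φ p k => φ (P.d^[k] p))
    (fun _ _ _ _ => rfl)
    (fun P φ p p' => funext fun k => by rw [iterate_map_add, map_add]; rfl)
    (fun P Q t ht ψ p => funext fun k => by
      have h : Function.Semiconj t P.d Q.d := ht
      rw [← (h.iterate_right k).eq, LinearMap.comp_apply])

theorem pairing_mk {P : DiffMod} (φ : Dl P) (p : P) (k : ℕ) :
    pairing (mk φ p) k = φ (P.d^[k] p) := congrFun (liftF_mk _ _ _ _ φ p) k

theorem eq_zero_of_src_mul_eq_zero {a : A} (ha : a ≠ 0) {z : U} (h : src a * z = 0) : z = 0 := by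
  obtain ⟨P, φ, p, rfl⟩ := exists_eq_mk z
  refine mk_eq_zero_of_forall_iterate fun k => ?_
  have hk := congrFun (congrArg pairing h) k
  rw [src_mul_mk, pairing_mk, map_zero, Pi.zero_apply, LinearMap.smul_apply] at hk
  exact (smul_eq_zero.mp hk).resolve_left ha

/-- The antipode exchanges source and target, so torsion-freeness on the source side carries over
to the target side. -/
theorem eq_zero_of_tgt_mul_eq_zero {a : A} (ha : a ≠ 0) {z : U} (h : tgt a * z = 0) : z = 0 := by
  have hS := congrArg antipode h
  have ht : antipode (tgt a) = src a := antipodeAdd_unit 1 a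
  rw [map_mul, map_zero, ht] at hS
  rw [← antipode_antipode z, eq_zero_of_src_mul_eq_zero ha hS, map_zero]

instance : Module.IsTorsionFree A (Via (srcMap ℂ A U)) :=
  isTorsionFree_via fun a ha _ h => eq_zero_of_src_mul_eq_zero ha (srcMap_eq a ▸ h)

instance : Module.IsTorsionFree A (Via (tgtMap ℂ A U)) :=
  isTorsionFree_via fun a ha _ h => eq_zero_of_tgt_mul_eq_zero ha (tgtMap_eq a ▸ h)

/-! ### The matrix of coefficients and its determinant -/

/-- The order reversal in the product of `U°` cancels that in `starRev` and `tmulRev`. -/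
theorem mk_starRev_tmulRev {M : DiffMod} (n : ℕ) (φ : Fin n → Dl M) (x : Fin n → M) :
    mk (starRev n φ) (tmulRev n x) = ∏ i, mk (φ i) (x i) := by
  induction n with
  | zero => rw [Fin.prod_univ_zero]; rfl
  | succ n ih =>
    rw [Fin.prod_univ_castSucc, ← ih, mk_mul]
    rfl

variable {M : DiffMod} {m : ℕ} (e : Module.Basis (Fin m) A M)

theorem detM_eq_det : detM e = (uMat e).det := by
  rw [← Matrix.det_transpose, Matrix.det_apply, detM, detVec, mk_sum_right]
  refine Finset.sum_congr rfl fun σ _ => ?_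
  rw [← mkHom_apply, map_zsmul, mkHom_apply, mk_starRev_tmulRev]
  rfl

theorem comul_uMat (i j : Fin m) :
    comul (uMat e i j) = ∑ k, fst ℂ A U (uMat e i k) * snd ℂ A U (uMat e k j) :=
  comul_mk e (e.coord i) (e j)

theorem counit_uMat (i j : Fin m) : counit (uMat e i j) = (1 : Matrix (Fin m) (Fin m) A) i j := by
  rw [uMat, counit_mk, Module.Basis.coord_apply, Module.Basis.repr_self, Finsupp.single_apply,
    Matrix.one_apply]
  simp only [eq_comm]

/-- The antipode inverts the matrix of coefficients: this is the axiom `h₁ S(h₂) = s(ε(h))` at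
`h = u_{ij}`. -/
theorem uMat_mul_antipode : uMat e * (uMat e).map hopf.antipode = 1 := by
  ext i j
  have h := hopf.mul_antipode (uMat e i j)
  change BTlift _ _ _ _ _ (comul (uMat e i j)) = srcMap ℂ A U (counit (uMat e i j)) at h
  rw [comul_uMat, counit_uMat, Matrix.one_apply, apply_ite (srcMap ℂ A U), map_one, map_zero] at h
  simp only [map_sum, map_mul, BTlift_inl, BTlift_inr, RingHom.id_apply] at h
  rw [Matrix.mul_apply, Matrix.one_apply]
  exact h

theorem detM_mul_antipode : detM e * hopf.antipode (detM e) = 1 := by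
  rw [detM_eq_det, RingHom.map_det, RingHom.mapMatrix_apply, ← Matrix.det_mul,
    uMat_mul_antipode, Matrix.det_one]

theorem isUnit_detM : IsUnit (detM e) := IsUnit.of_mul_eq_one _ (detM_mul_antipode e)

theorem antipode_detM : hopf.antipode (detM e) = Ring.inverse (detM e) := by
  rw [← one_mul (hopf.antipode _), ← Ring.inverse_mul_cancel _ (isUnit_detM e), mul_assoc,
    detM_mul_antipode, mul_one]

theorem antipode_uMat (i j : Fin m) : hopf.antipode (uMat e i j) =
    Ring.inverse (detM e) * (uMat e).adjugate i j := by
  have h : (uMat e).adjugate = detM e • (uMat e).map hopf.antipode := by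
    rw [← mul_one (uMat e).adjugate, ← uMat_mul_antipode e, ← mul_assoc, Matrix.adjugate_mul,
      smul_mul_assoc, one_mul, detM_eq_det]
  rw [h, Matrix.smul_apply, smul_eq_mul, ← mul_assoc,
    Ring.inverse_mul_cancel _ (isUnit_detM e), one_mul, Matrix.map_apply]

theorem comul_detM : comul (detM e) = fst ℂ A U (detM e) * snd ℂ A U (detM e) := by
  rw [detM_eq_det, RingHom.map_det, RingHom.map_det, RingHom.map_det, ← Matrix.det_mul]
  congr 1
  ext i j
  exact comul_uMat e i j

/-- Since `det_M` is grouplike, so is its inverse. -/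
theorem comul_inverse_detM : comul (Ring.inverse (detM e)) =
    fst ℂ A U (Ring.inverse (detM e)) * snd ℂ A U (Ring.inverse (detM e)) := by
  have h := Ring.mul_inverse_cancel _ (isUnit_detM e)
  have h1 : comul (detM e) * comul (Ring.inverse (detM e)) = 1 := by
    rw [← map_mul, h, map_one]
  have h2 : comul (detM e) *
      (fst ℂ A U (Ring.inverse (detM e)) * snd ℂ A U (Ring.inverse (detM e))) = 1 := by
    rw [comul_detM, mul_mul_mul_comm, ← map_mul, ← map_mul, h, map_one, map_one, mul_one]
  exact (IsUnit.of_mul_eq_one _ h1).mul_left_cancel (h1.trans h2.symm)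

/-! ### The subalgebras `U°_M` and `U°_M[det_M⁻¹]` -/

theorem mk_mem_UM (φ : Dl M) (x : M) : mk φ x ∈ UM M := Algebra.subset_adjoin ⟨φ, x, rfl⟩

theorem detM_mem_UM : detM e ∈ UM M := by
  rw [detM_eq_det]
  exact det_mem_subalgebra (UM M) fun _ _ => mk_mem_UM _ _

theorem adjugate_uMat_mem_UM (i j : Fin m) : (uMat e).adjugate i j ∈ UM M :=
  adjugate_mem_subalgebra (UM M) (fun _ _ => mk_mem_UM _ _) i j

theorem inverse_detM_mem_UMdet : Ring.inverse (detM e) ∈ UMdet e :=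
  Algebra.subset_adjoin (Or.inr rfl)

theorem mk_eq_sum_uMat (φ : Dl M) (x : M) :
    mk φ x = ∑ i, ∑ j, src (φ (e i)) * (tgt (e.coord j x) * uMat e i j) := by
  conv_lhs => rw [← sum_coord e φ, ← sum_basis e x, mk_sum_left]
  refine Finset.sum_congr rfl fun i _ => ?_
  rw [mk_sum_right]
  refine Finset.sum_congr rfl fun j _ => ?_
  rw [uMat, tgt_mul_mk, src_mul_mk]

theorem comul_mem_range_of_mem_UM {W : Subalgebra (A ⊗[ℂ] A) U} (hW : UM M ≤ W) {u : U}
    (hu : u ∈ UM M) : comul u ∈ (inclTensor W).range := by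
  refine comul_mem_range_of_mem_adjoin bialg W ?_ hu
  rintro _ ⟨φ, x, rfl⟩
  change comul (mk φ x) ∈ _
  rw [comul_mk (Module.Free.chooseBasis A M)]
  exact sum_mem fun i _ => mul_mem ⟨_, inclTensor_fst W ⟨_, hW (mk_mem_UM _ _)⟩⟩
    ⟨_, inclTensor_snd W ⟨_, hW (mk_mem_UM _ _)⟩⟩

theorem comul_mem_range_of_mem_UMdet {u : U} (hu : u ∈ UMdet e) :
    comul u ∈ (inclTensor (UMdet e)).range := by
  refine comul_mem_range_of_mem_adjoin bialg (UMdet e) ?_ hu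
  rintro x (hx | rfl)
  · exact comul_mem_range_of_mem_UM (UM_le_UMdet e) hx
  · change comul _ ∈ _
    rw [comul_inverse_detM]
    exact mul_mem ⟨_, inclTensor_fst _ ⟨_, inverse_detM_mem_UMdet e⟩⟩
      ⟨_, inclTensor_snd _ ⟨_, inverse_detM_mem_UMdet e⟩⟩

theorem antipode_mem_UMdet {u : U} (hu : u ∈ UMdet e) : hopf.antipode u ∈ UMdet e := by
  refine antipode_mem_of_mem_adjoin hopf (UMdet e) ?_ hu
  rintro x (hx | rfl)
  · refine antipode_mem_of_mem_adjoin hopf (UMdet e) ?_ hx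
    rintro _ ⟨φ, x, rfl⟩
    rw [mk_eq_sum_uMat e, map_sum]
    refine sum_mem fun i _ => ?_
    rw [map_sum]
    refine sum_mem fun j _ => ?_
    rw [map_mul, map_mul, ← srcMap_eq, ← tgtMap_eq, hopf.antipode_src, hopf.antipode_tgt,
      antipode_uMat]
    exact mul_mem (tgtMap ℂ A (UMdet e) _).2 (mul_mem (srcMap ℂ A (UMdet e) _).2
      (mul_mem (inverse_detM_mem_UMdet e) (UM_le_UMdet e (adjugate_uMat_mem_UM e i j))))
  · rw [← antipode_detM, hopf.antipode_antipode]
    exact UM_le_UMdet e (detM_mem_UM e)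

end FinDual

theorem proposition5p7 (M : FinDual.DiffMod) (m : ℕ)
    (e : Module.Basis (Fin m) (Polynomial ℂ) M) :
    FinDual.IsSubBialgebroid FinDual.hopf.toCommBialgebroid (FinDual.UM M) ∧
    (∃ hdet : FinDual.detM e ∈ FinDual.UM M,
      IsUnit (FinDual.detM e) ∧
      FinDual.IsLocalizationAt (FinDual.UM M) (FinDual.UMdet e) (FinDual.UM_le_UMdet e)
        ⟨FinDual.detM e, hdet⟩) ∧
    FinDual.IsHopfSubalgebroid FinDual.hopf (FinDual.UMdet e) ∧
    (∀ i j : Fin m, FinDual.hopf.antipode (FinDual.uMat e i j) =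
      Ring.inverse (FinDual.detM e) * (FinDual.uMat e).adjugate i j) ∧
    FinDual.hopf.antipode (FinDual.detM e) = Ring.inverse (FinDual.detM e) :=
  ⟨FinDual.isSubBialgebroid_of_comul_mem _ _
      fun _ hu => FinDual.comul_mem_range_of_mem_UM le_rfl hu,
    ⟨FinDual.detM_mem_UM e, FinDual.isUnit_detM e,
      FinDual.isLocalizationAt_adjoin_inverse (FinDual.UM M) ⟨_, FinDual.detM_mem_UM e⟩
        (Ring.inverse (FinDual.detM e)) (Ring.mul_inverse_cancel _ (FinDual.isUnit_detM e)) _⟩,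
    FinDual.isHopfSubalgebroid_of_comul_mem _ _
      (fun _ hu => FinDual.comul_mem_range_of_mem_UMdet e hu)
      fun _ hu => FinDual.antipode_mem_UMdet e hu,
    FinDual.antipode_uMat e, FinDual.antipode_detM e⟩
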